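/- Let $\mathbf N=\{1,2,3,\dots\}$ and let $\mathcal O_\infty$ be the Cuntz algebra, that is, the unital C*-algebra universally generated by elements $s_i$ ($i\in\mathbf N$) with $s_i^*s_j=\delta_{ij}I$ and $\sum_{i=1}^k s_is_i^*\le I$ for all $k\in\mathbf N$. A representation of $\mathcal O_\infty$ is a unital $*$-homomorphism $\pi$ from $\mathcal O_\infty$ to the bounded operators on a complex Hilbert space $\mathcal H$. Two representations $(\mathcal H_1,\pi_1)$, $(\mathcal H_2,\pi_2)$ are unitarily equivalent if $u\pi_1(\cdot)u^*=\pi_2(\cdot)$ for a unitary $u$ from $\mathcal H_1$ onto $\mathcal H_2$. A representation on $\mathcal H\neq0$ is irreducible if $\{0\}$ and $\mathcal H$ are the only invariant closed subspaces; a representation is multiplicity free if no two distinct subrepresentations (restrictions to invariant closed subspaces) are unitarily equivalent; it is permutative if $\mathcal H$ has an orthonormal basis $\mathcal E$ with $\pi(s_i)\mathcal E\subset\mathcal E$ for all $i$. For $J=(j_1,\dots,j_k)\in\mathbf N^k$, $1\le k<\infty$, put $s_J=s_{j_1}\cdots s_{j_k}$ and let $P(J)$ be the class of representations having a cyclic unit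 vector $v$ such that $\pi(s_J)v=v$ and $\{\pi(s_{j_l}\cdots s_{j_k})v\}_{l=1}^k$ is an orthonormal family. For $J=(j_l)_{l\ge1}\in\mathbf N^\infty$ let $P(J)$ be the class of representations having a cyclic unit vector $v$ such that $\{\pi(s_{j_1}\cdots s_{j_n})^*v : n\ge1\}$ is an orthonormal family. Let $\Omega=[0,1]\setminus\mathbf Q$. For $x\in\Omega$ let $\mathrm{CFE}(x)=(a_1,a_2,\dots)\in\mathbf N^\infty$ be the unique sequence with $x=1/(a_1+1/(a_2+1/(a_3+\cdots)))$. Call $x\in\Omega$ a quadratic irrational if $ax^2+bx+c=0$ for some integers $a\ne0$, $b$, $c$. A nonempty finite sequence $J$ is a repeating block of a sequence $a\in\mathbf N^\infty$ if $a$ consists of a finite (possibly empty) initial block not ending with a copy of $J$, followed by infinitely many copies of $J$, and no shorter nonempty block arises from $a$ in this way; it is determined by $a$ up to cyclic permutation. For real $x,y$ write $x\sim y$ if $x=(ay+b)/(cy+d)$ with $a,b,c,d\in\mathbf Z$ and $ad-bc=\pm1$. This is an equivalence relation on $\Omega$; let $[x]=\{y\in\Omega: y\sim x\}$. Let $l_2(\Omega)$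 be the complex Hilbert space with orthonormal basis $\{e_x:x\in\Omega\}$, and let $\pi_\alpha$ be the representation of $\mathcal O_\infty$ on $l_2(\Omega)$ with $\pi_\alpha(s_i)e_x=e_{1/(x+i)}$ for $x\in\Omega$, $i\in\mathbf N$. For $x\in\Omega$ let $\mathcal H_{[x]}$ be the closed subspace of $l_2(\Omega)$ generated by $\{e_y:y\in[x]\}$. **Theorem.** (i) Each $\mathcal H_{[x]}$ is invariant under $\pi_\alpha$, $l_2(\Omega)=\bigoplus_{[x]\in\Omega/\sim}\mathcal H_{[x]}$ (Hilbert space direct sum), and each subrepresentation $\eta_{[x]}=\pi_\alpha|_{\mathcal H_{[x]}}$ is irreducible. (ii) For $x,y\in\Omega$, $\eta_{[x]}$ and $\eta_{[y]}$ are unitarily equivalent if and only if $x\sim y$. Moreover $\pi_\alpha$ is multiplicity free. (iii) (a) If $x\in\Omega$ is not a quadratic irrational, then $\eta_{[x]}$ belongs to $P(\mathrm{CFE}(x))$. (b) If $x\in\Omega$ is a quadratic irrational, then $\mathrm{CFE}(x)$ has a repeating block, and $\eta_{[x]}$ belongs to $P(J)$ for every repeating block $J$ of $\mathrm{CFE}(x)$.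 (iv) Every irreducible permutative representation $(\mathcal H,\pi)$ of $\mathcal O_\infty$ for which $\mathcal H$ is the orthogonal Hilbert sum $\bigoplus_{i\in\mathbf N}\pi(s_i)\mathcal H$ is unitarily equivalent to $\eta_{[x]}$ for some $x\in\Omega$. -/

import Mathlib

open scoped ENNReal lp Topology

noncomputable section

/-! ## The Cuntz algebra `O_∞` -/

/-- The relations of the canonical generators of `O_∞`: `sᵢ* sⱼ = δᵢⱼ 1` and
`s₁ s₁* + ⋯ + sₖ sₖ* ≤ 1` for all `k`.  In a C⋆-algebra `a ≤ b` means that `b - a` is positive,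
that is, of the form `c* c`. -/
def IsCuntzFamily {B : Type*} [CStarAlgebra B] (t : ℕ+ → B) : Prop :=
  (∀ i j, star (t i) * t j = if i = j then 1 else 0) ∧
    ∀ k : ℕ+, ∃ c : B, 1 - ∑ i ∈ Finset.Icc 1 k, t i * star (t i) = star c * c

theorem IsCuntzFamily.of_star_mul {B : Type*} [CStarAlgebra B] {t : ℕ+ → B}
    (h : ∀ i j, star (t i) * t j = if i = j then 1 else 0) : IsCuntzFamily t := by
  refine ⟨h, fun k => ?_⟩
  set p := ∑ i ∈ Finset.Icc 1 k, t i * star (t i) with hp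
  have hs : star p = p := by simp [hp, star_sum]
  have hpp : p * p = p := by
    rw [hp, Finset.sum_mul_sum]
    refine Finset.sum_congr rfl fun i hi => ?_
    rw [Finset.sum_eq_single i]
    · rw [mul_assoc, ← mul_assoc (star (t i)), h]; simp
    · intro j _ hj
      rw [mul_assoc, ← mul_assoc (star (t i)), h]; simp [hj.symm]
    · exact fun h' => absurd hi h'
  refine ⟨1 - p, ?_⟩
  simp [hs, sub_mul, mul_sub, hpp]

theorem IsCuntzFamily.norm_le_one {B : Type*} [CStarAlgebra B] [Nontrivial B] {t : ℕ+ → B}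
    (h : IsCuntzFamily t) (i : ℕ+) : ‖t i‖ ≤ 1 := by
  have h1 : star (t i) * t i = 1 := by simpa using h.1 i i
  have h2 := CStarRing.norm_star_mul_self (x := t i)
  rw [h1, CStarRing.norm_one] at h2
  nlinarith [norm_nonneg (t i)]

/-- A realization of the relations of `O_∞` in a (unital, nonzero) C⋆-algebra. -/
structure CuntzRealization : Type 1 where
  carrier : Type
  [cstar : CStarAlgebra carrier]
  [nontriv : Nontrivial carrier]
  gen : ℕ+ → carrier
  isCuntz : IsCuntzFamily gen

attribute [instance] CuntzRealization.cstar CuntzRealization.nontriv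

/-- The C⋆-algebra of all bounded families indexed by the realizations. -/
abbrev CuntzProduct : Type 1 := lp (fun r : CuntzRealization => r.carrier) ∞

instance : CStarAlgebra CuntzProduct where

/-- The universal family of generators: its component at each realization is the generator there. -/
def cuntzUniversal (i : ℕ+) : CuntzProduct :=
  ⟨fun r => r.gen i, memℓp_infty ⟨1, by rintro _ ⟨r, rfl⟩; exact r.isCuntz.norm_le_one i⟩⟩

/-- The closed `*`-subalgebra generated by the universal family. -/
def cuntzSubalgebra : StarSubalgebra ℂ CuntzProduct :=
  (StarAlgebra.adjoin ℂ (Set.range cuntzUniversal)).topologicalClosure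

instance : IsClosed (cuntzSubalgebra : Set CuntzProduct) :=
  StarSubalgebra.isClosed_topologicalClosure _

/-- The Cuntz algebra `O_∞`: the C⋆-algebra universally generated by the canonical generators.
(A C⋆-algebra generated by a countable set has at most the cardinality of the continuum, so the
realizations in `Type` exhaust all of them up to isomorphism of the generated algebra.) -/
abbrev CuntzAlgebra : Type 1 := cuntzSubalgebra

instance : CStarAlgebra CuntzAlgebra := StarSubalgebra.cstarAlgebra cuntzSubalgebra

/-- The canonical generators `sᵢ` of `O_∞`. -/
def cuntzGen (i : ℕ+) : CuntzAlgebra :=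
  ⟨cuntzUniversal i,
    StarSubalgebra.le_topologicalClosure _ (StarAlgebra.subset_adjoin ℂ _ ⟨i, rfl⟩)⟩

theorem isCuntzFamily_cuntzGen : IsCuntzFamily cuntzGen := by
  refine IsCuntzFamily.of_star_mul fun i j => Subtype.ext (lp.ext (funext fun r => ?_))
  have h := r.isCuntz.1 i j
  by_cases hij : i = j
  · simp only [hij, if_true] at h ⊢
    exact h
  · simp only [hij, if_false] at h ⊢
    exact h

/-- The unital `*`-homomorphism of `O_∞` that sends the canonical generators to a given family
satisfying the relations. -/
def cuntzLift {B : Type} [CStarAlgebra B] [Nontrivial B] (t : ℕ+ → B) (ht : IsCuntzFamily t) :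
    CuntzAlgebra →⋆ₐ[ℂ] B where
  toFun a := (a : CuntzProduct) (CuntzRealization.mk B t ht)
  map_one' := rfl
  map_mul' _ _ := rfl
  map_zero' := rfl
  map_add' _ _ := rfl
  commutes' _ := rfl
  map_star' _ := rfl

theorem cuntzLift_gen {B : Type} [CStarAlgebra B] [Nontrivial B] (t : ℕ+ → B)
    (ht : IsCuntzFamily t) (i : ℕ+) : cuntzLift t ht (cuntzGen i) = t i := rfl

/-- Homomorphisms out of `O_∞` are determined by the canonical generators. -/
theorem cuntz_hom_ext {B : Type*} [CStarAlgebra B] (f g : CuntzAlgebra →⋆ₐ[ℂ] B)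
    (h : ∀ i, f (cuntzGen i) = g (cuntzGen i)) : f = g := by
  have hf : Continuous f := AddMonoidHomClass.continuous_of_bound f 1 (fun a => by simpa using NonUnitalStarAlgHom.norm_apply_le f a)
  have hg : Continuous g := AddMonoidHomClass.continuous_of_bound g 1 (fun a => by simpa using NonUnitalStarAlgHom.norm_apply_le g a)
  refine StarAlgHom.ext_topologicalClosure
    (S := StarAlgebra.adjoin ℂ (Set.range cuntzUniversal)) hf hg ?_
  refine StarAlgHom.ext_adjoin ?_
  rintro ⟨_, _⟩ ⟨i, rfl⟩
  exact h i

/-! ## Representations of `O_∞` -/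

section Representations

variable {H : Type*} [NormedAddCommGroup H] [InnerProductSpace ℂ H] [CompleteSpace H]
variable {H' : Type*} [NormedAddCommGroup H'] [InnerProductSpace ℂ H'] [CompleteSpace H']

/-- `K` is invariant under all operators `π(a)`, `a ∈ O_∞`. -/
def IsInvariantSubspace (π : CuntzAlgebra →⋆ₐ[ℂ] (H →L[ℂ] H)) (K : Submodule ℂ H) : Prop :=
  ∀ a, ∀ v ∈ K, π a v ∈ K

/-- The restriction of a representation to an invariant closed (equivalently, complete)
subspace. -/
def subrep (π : CuntzAlgebra →⋆ₐ[ℂ] (H →L[ℂ] H)) (K : Submodule ℂ H) [CompleteSpace K]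
    (hK : IsInvariantSubspace π K) : CuntzAlgebra →⋆ₐ[ℂ] (K →L[ℂ] K) where
  toFun a := ((π a).comp K.subtypeL).codRestrict K fun v => hK a v v.2
  map_one' := by ext v; simp
  map_mul' a b := by ext v; change π (a * b) (v : H) = π a (π b (v : H)); rw [map_mul]; rfl
  map_zero' := by ext v; simp
  map_add' a b := by ext v; change π (a + b) (v : H) = π a (v : H) + π b (v : H); rw [map_add]; rfl
  commutes' c := by ext v; simp [Algebra.algebraMap_eq_smul_one]
  map_star' a := by
    rw [ContinuousLinearMap.star_eq_adjoint, ContinuousLinearMap.eq_adjoint_iff]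
    intro v w
    rw [Submodule.coe_inner, Submodule.coe_inner]
    change inner ℂ (π (star a) (v : H)) (w : H) = inner ℂ (v : H) (π a (w : H))
    rw [map_star, ContinuousLinearMap.star_eq_adjoint, ContinuousLinearMap.adjoint_inner_left]

theorem subrep_apply (π : CuntzAlgebra →⋆ₐ[ℂ] (H →L[ℂ] H)) (K : Submodule ℂ H) [CompleteSpace K]
    (hK : IsInvariantSubspace π K) (a : CuntzAlgebra) (v : K) : (subrep π K hK a v : H) = π a v := rfl

/-- Unitary equivalence: some unitary `U` satisfies `U π(a) U* = π'(a)` for all `a ∈ O_∞`. -/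
def UnitarilyEquivalent (π : CuntzAlgebra →⋆ₐ[ℂ] (H →L[ℂ] H))
    (π' : CuntzAlgebra →⋆ₐ[ℂ] (H' →L[ℂ] H')) : Prop :=
  ∃ U : H ≃ₗᵢ[ℂ] H', ∀ a v, U (π a (U.symm v)) = π' a v

/-- The space is nonzero and has no invariant closed subspaces except `0` and itself. -/
def IsIrreducibleRep (π : CuntzAlgebra →⋆ₐ[ℂ] (H →L[ℂ] H)) : Prop :=
  Nontrivial H ∧
    ∀ K : Submodule ℂ H, IsClosed (K : Set H) → IsInvariantSubspace π K → K = ⊥ ∨ K = ⊤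

/-- No two different subrepresentations are unitarily equivalent. -/
def IsMultiplicityFree (π : CuntzAlgebra →⋆ₐ[ℂ] (H →L[ℂ] H)) : Prop :=
  ∀ (K L : Submodule ℂ H) [CompleteSpace K] [CompleteSpace L]
    (hK : IsInvariantSubspace π K) (hL : IsInvariantSubspace π L),
    UnitarilyEquivalent (subrep π K hK) (subrep π L hL) → K = L

/-- Some orthonormal basis is mapped into itself by each `π(sᵢ)`. -/
def IsPermutativeRep (π : CuntzAlgebra →⋆ₐ[ℂ] (H →L[ℂ] H)) : Prop :=
  ∃ E : Set H, Orthonormal ℂ (Subtype.val : E → H) ∧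
    (Submodule.span ℂ E).topologicalClosure = ⊤ ∧
    ∀ i, ∀ e ∈ E, π (cuntzGen i) e ∈ E

/-- The space is the (orthogonal) Hilbert sum of the ranges of the `π(sᵢ)`. -/
def IsSumOfRanges (π : CuntzAlgebra →⋆ₐ[ℂ] (H →L[ℂ] H)) : Prop :=
  (⨆ i, LinearMap.range (π (cuntzGen i)).toLinearMap).topologicalClosure = ⊤

/-- `v` is cyclic: `π(O_∞) v` is dense. -/
def IsCyclicVector (π : CuntzAlgebra →⋆ₐ[ℂ] (H →L[ℂ] H)) (v : H) : Prop :=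
  DenseRange fun a => π a v

/-- The word `s_J = s_{j₁} ⋯ s_{jₖ}` for `J = (j₁, …, jₖ)`. -/
def cuntzWord (J : List ℕ+) : CuntzAlgebra := (J.map cuntzGen).prod

/-- The class `P(J)` for a nonempty finite sequence `J = (j₁, …, jₖ)`: there is a cyclic unit
vector `v` with `π(s_J) v = v` such that `π(s_{j_l} ⋯ s_{j_k}) v`, `1 ≤ l ≤ k`, is an orthonormal
family. -/
def IsCycleRep (J : List ℕ+) (π : CuntzAlgebra →⋆ₐ[ℂ] (H →L[ℂ] H)) : Prop :=
  J ≠ [] ∧ ∃ v : H, ‖v‖ = 1 ∧ IsCyclicVector π v ∧ π (cuntzWord J) v = v ∧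
    Orthonormal ℂ fun l : Fin J.length => π (cuntzWord (J.drop l)) v

/-- The class `P(J)` for an infinite sequence `J = (j₁, j₂, …)`, where `J n` is `j_{n+1}`: there is
a cyclic unit vector `v` such that `π(s_{j₁} ⋯ s_{jₙ})* v`, `n ≥ 1`, is an orthonormal family. -/
def IsChainRep (J : ℕ → ℕ+) (π : CuntzAlgebra →⋆ₐ[ℂ] (H →L[ℂ] H)) : Prop :=
  ∃ v : H, ‖v‖ = 1 ∧ IsCyclicVector π v ∧
    Orthonormal ℂ fun n : ℕ => star (π (cuntzWord (List.ofFn fun l : Fin (n + 1) => J l))) v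

end Representations

/-! ## Irrationals, continued fractions and modular equivalence -/

/-- The set `Ω` of all irrationals in `[0, 1]`. -/
def Omega : Set ℝ := {x | x ∈ Set.Icc (0 : ℝ) 1 ∧ Irrational x}

theorem omega_pos (x : Omega) : 0 < (x : ℝ) :=
  lt_of_le_of_ne x.2.1.1 fun h => x.2.2.ne_zero h.symm

theorem omega_lt_one (x : Omega) : (x : ℝ) < 1 :=
  lt_of_le_of_ne x.2.1.2 fun h => x.2.2.ne_one h

instance : Nonempty Omega := by
  obtain ⟨r, hr, h0, h1⟩ := exists_irrational_btwn (zero_lt_one (α := ℝ))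
  exact ⟨⟨r, ⟨h0.le, h1.le⟩, hr⟩⟩

/-- The finite continued fraction `1/(a₁ + 1/(a₂ + ⋯ + 1/(aₙ + y)))`. -/
def cfEval (w : List ℕ+) (y : ℝ) : ℝ := w.foldr (fun a z => 1 / ((a : ℝ) + z)) y

/-- `x = 1/(a₁ + 1/(a₂ + 1/(a₃ + ⋯)))`, where `a n` is `a_{n+1}`: the convergents
`1/(a₁ + 1/(a₂ + ⋯ + 1/aₙ))` tend to `x`. -/
def IsCFE (x : ℝ) (a : ℕ → ℕ+) : Prop :=
  Filter.Tendsto (fun n : ℕ => cfEval (List.ofFn fun l : Fin n => a l) 0) Filter.atTop (𝓝 x)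

theorem cfEval_mem (w : List ℕ+) {y : ℝ} (hy : y ∈ Set.Icc (0 : ℝ) 1) :
    cfEval w y ∈ Set.Icc (0 : ℝ) 1 := by
  induction w with
  | nil => exact hy
  | cons a w ih =>
    have ha : (1 : ℝ) ≤ a := by exact_mod_cast a.2
    have h0 := ih.1
    change 1 / ((a : ℝ) + cfEval w y) ∈ _
    constructor
    · positivity
    · rw [div_le_one (by linarith)]; linarith

theorem abs_cfEval_sub_le : ∀ (w : List ℕ+) {y z : ℝ}, y ∈ Set.Icc (0 : ℝ) 1 →
    z ∈ Set.Icc (0 : ℝ) 1 → |cfEval w y - cfEval w z| ≤ 2 * (1 / 2) ^ w.length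
  | [], y, z, hy, hz => by
    change |y - z| ≤ _
    rw [abs_le]; constructor <;> simp <;> linarith [hy.1, hy.2, hz.1, hz.2]
  | [a], y, z, hy, hz => by
    have h1 := cfEval_mem [a] hy
    have h2 := cfEval_mem [a] hz
    rw [abs_le]; constructor <;> simp <;> linarith [h1.1, h1.2, h2.1, h2.2]
  | a :: b :: w, y, z, hy, hz => by
    have ih := abs_cfEval_sub_le w hy hz
    have hu := cfEval_mem w hy
    have hv := cfEval_mem w hz
    have ha : (1 : ℝ) ≤ a := by exact_mod_cast a.2
    have hb : (1 : ℝ) ≤ b := by exact_mod_cast b.2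
    change |1 / ((a : ℝ) + 1 / ((b : ℝ) + cfEval w y)) -
      1 / ((a : ℝ) + 1 / ((b : ℝ) + cfEval w z))| ≤ _
    set u := cfEval w y
    set v := cfEval w z
    have hu0 := hu.1
    have hv0 := hv.1
    have key : 1 / ((a : ℝ) + 1 / ((b : ℝ) + u)) - 1 / ((a : ℝ) + 1 / ((b : ℝ) + v)) =
        (u - v) / ((a * (b + u) + 1) * (a * (b + v) + 1)) := by
      have : (b : ℝ) + u ≠ 0 := by positivity
      have : (b : ℝ) + v ≠ 0 := by positivity
      have : (a : ℝ) * (b + u) + 1 ≠ 0 := by positivity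
      have : (a : ℝ) * (b + v) + 1 ≠ 0 := by positivity
      field_simp
      ring
    have h1 : (2 : ℝ) ≤ a * (b + u) + 1 := by nlinarith
    have h2 : (2 : ℝ) ≤ a * (b + v) + 1 := by nlinarith
    rw [key, abs_div, abs_of_pos (a := (_ * _ : ℝ)) (by positivity), div_le_iff₀ (by positivity)]
    have h4 : (4 : ℝ) ≤ (a * (b + u) + 1) * (a * (b + v) + 1) := by nlinarith
    have hp : (0 : ℝ) < (1 / 2) ^ w.length := by positivity
    simp only [List.length_cons, pow_succ]
    nlinarith

theorem cfEval_ofFn_succ (a : ℕ → ℕ+) (n : ℕ) (y : ℝ) :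
    cfEval (List.ofFn fun l : Fin (n + 1) => a l) y =
      1 / ((a 0 : ℝ) + cfEval (List.ofFn fun l : Fin n => a (l + 1)) y) := by
  rw [List.ofFn_succ]; rfl

/-- If `x = 1/(a₁ + y)` with `y` in the unit interval and `x` irrational, then `a₁` and `y` are
determined by `x`. -/
theorem cf_head_unique {x y z : ℝ} {a b : ℕ+} (hx : Irrational x) (hy : y ∈ Set.Icc (0 : ℝ) 1)
    (hz : z ∈ Set.Icc (0 : ℝ) 1) (h1 : x = 1 / ((a : ℝ) + y)) (h2 : x = 1 / ((b : ℝ) + z)) :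
    a = b ∧ y = z := by
  have ha : (1 : ℝ) ≤ a := by exact_mod_cast a.2
  have hb : (1 : ℝ) ≤ b := by exact_mod_cast b.2
  have hxa : x⁻¹ = a + y := by rw [h1]; simp
  have hxb : x⁻¹ = b + z := by rw [h2]; simp
  have hir : Irrational x⁻¹ := irrational_inv_iff.2 hx
  have hy1 : y ≠ 1 := by
    rintro rfl
    exact hir ⟨(a : ℕ) + 1, by rw [hxa]; push_cast; rfl⟩
  have hz1 : z ≠ 1 := by
    rintro rfl
    exact hir ⟨(b : ℕ) + 1, by rw [hxb]; push_cast; rfl⟩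
  have hy2 := lt_of_le_of_ne hy.2 hy1
  have hz2 := lt_of_le_of_ne hz.2 hz1
  have hf : ⌊x⁻¹⌋ = ((a : ℕ) : ℤ) := by
    rw [Int.floor_eq_iff]; constructor <;> push_cast <;> linarith [hy.1]
  have hg : ⌊x⁻¹⌋ = ((b : ℕ) : ℤ) := by
    rw [Int.floor_eq_iff]; constructor <;> push_cast <;> linarith [hz.1]
  have hab : a = b := by
    apply PNat.coe_injective
    exact_mod_cast hf.symm.trans hg
  subst hab
  exact ⟨rfl, by linarith⟩

theorem IsCFE.mem {x : ℝ} {a : ℕ → ℕ+} (h : IsCFE x a) : x ∈ Set.Icc (0 : ℝ) 1 :=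
  isClosed_Icc.mem_of_tendsto h
    (Filter.Eventually.of_forall fun _ => cfEval_mem _ (by simp))

theorem isCFE_tail {x : ℝ} {a : ℕ → ℕ+} (h : IsCFE x a) (hx : 0 < x) :
    IsCFE (x⁻¹ - a 0) (fun n => a (n + 1)) := by
  have h1 := (Filter.tendsto_add_atTop_iff_nat 1).2 h
  have h2 := (h1.inv₀ hx.ne').sub_const (a 0 : ℝ)
  refine h2.congr fun n => ?_
  rw [cfEval_ofFn_succ]
  simp

theorem IsCFE.unique {a b : ℕ → ℕ+} {x : ℝ} (hx : Irrational x) (ha : IsCFE x a)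
    (hb : IsCFE x b) : a = b := by
  have key : ∀ n, ∀ (a b : ℕ → ℕ+) (x : ℝ), Irrational x → IsCFE x a → IsCFE x b →
      a n = b n := by
    intro n
    have head : ∀ (a b : ℕ → ℕ+) (x : ℝ), Irrational x → IsCFE x a → IsCFE x b →
        a 0 = b 0 ∧ x⁻¹ - a 0 = x⁻¹ - b 0 ∧ 0 < x := by
      intro a b x hx ha hb
      have hx0 : 0 < x := lt_of_le_of_ne ha.mem.1 fun h => hx.ne_zero h.symm
      obtain ⟨h1, h2⟩ := cf_head_unique (a := a 0) (b := b 0) hx (isCFE_tail ha hx0).mem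
        (isCFE_tail hb hx0).mem (by simp) (by simp)
      exact ⟨h1, h2, hx0⟩
    induction n with
    | zero => exact fun a b x hx ha hb => (head a b x hx ha hb).1
    | succ n ih =>
      intro a b x hx ha hb
      obtain ⟨h1, h2, hx0⟩ := head a b x hx ha hb
      refine ih (fun n => a (n + 1)) (fun n => b (n + 1)) (x⁻¹ - a 0) ?_ (isCFE_tail ha hx0) ?_
      · exact_mod_cast (irrational_inv_iff.2 hx).sub_natCast (a 0 : ℕ)
      · rw [h2]; exact isCFE_tail hb hx0
  exact funext fun n => key n a b x hx ha hb

theorem omega_floor_pos (x : Omega) : 0 < ⌊(x : ℝ)⁻¹⌋₊ :=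
  Nat.floor_pos.2 ((one_le_inv₀ (omega_pos x)).2 x.2.1.2)

/-- The Gauss map `x ↦ 1/x - ⌊1/x⌋`. -/
def gaussMap (x : Omega) : Omega :=
  ⟨(x : ℝ)⁻¹ - ⌊(x : ℝ)⁻¹⌋₊, by
    have h1 := Nat.floor_le (inv_nonneg.2 x.2.1.1)
    have h2 := Nat.lt_floor_add_one (x : ℝ)⁻¹
    exact ⟨⟨by linarith, by linarith⟩, (irrational_inv_iff.2 x.2.2).sub_natCast _⟩⟩

theorem exists_isCFE (x : Omega) : ∃ a : ℕ → ℕ+, IsCFE x a := by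
  let a : Omega → ℕ → ℕ+ := fun x n => ⟨_, omega_floor_pos (gaussMap^[n] x)⟩
  have ha : ∀ x n, a x (n + 1) = a (gaussMap x) n := fun x n => rfl
  have key : ∀ n x, cfEval (List.ofFn fun l : Fin n => a x l) (gaussMap^[n] x : Omega) = x := by
    intro n
    induction n with
    | zero => intro x; rfl
    | succ n ih =>
      intro x
      rw [cfEval_ofFn_succ]
      have := ih (gaussMap x)
      simp only [ha, Function.iterate_succ_apply]
      rw [this]
      simp [a, gaussMap]
  refine ⟨a x, ?_⟩
  have h0 : Filter.Tendsto (fun n : ℕ => 2 * (1 / 2 : ℝ) ^ n) Filter.atTop (𝓝 0) := by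
    simpa using (tendsto_pow_atTop_nhds_zero_of_lt_one (by norm_num : (0 : ℝ) ≤ 1 / 2)
      (by norm_num)).const_mul 2
  rw [IsCFE, tendsto_iff_norm_sub_tendsto_zero]
  refine squeeze_zero (fun _ => norm_nonneg _) (fun n => ?_) h0
  have := abs_cfEval_sub_le (List.ofFn fun l : Fin n => a x l) (y := 0) (by simp)
    (gaussMap^[n] x).2.1
  rw [key] at this
  simpa using this

theorem existsUnique_isCFE (x : Omega) : ∃! a : ℕ → ℕ+, IsCFE x a := by
  obtain ⟨a, ha⟩ := exists_isCFE x
  exact ⟨a, ha, fun b hb => IsCFE.unique x.2.2 hb ha⟩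

/-- The continued fraction expansion map: the unique sequence of positive integers with
`x = 1/(a₁ + 1/(a₂ + ⋯))`. -/
def cfe (x : Omega) : ℕ → ℕ+ := (existsUnique_isCFE x).choose

theorem isCFE_cfe (x : Omega) : IsCFE x (cfe x) := (existsUnique_isCFE x).choose_spec.1

/-- `x` is a quadratic irrational: it solves a quadratic equation with integral coefficients. -/
def IsQuadratic (x : Omega) : Prop :=
  ∃ a b c : ℤ, a ≠ 0 ∧ (a : ℝ) * (x : ℝ) ^ 2 + b * x + c = 0

/-- The sequence `a` is the initial block `m` followed by infinitely many copies of the nonempty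
block `J`. -/
def IsPeriodicWith (a : ℕ → ℕ+) (m J : List ℕ+) : Prop :=
  J ≠ [] ∧ (∀ (i : ℕ) (h : i < m.length), a i = m[i]) ∧
    ∀ (n i : ℕ) (h : i < J.length), a (m.length + n * J.length + i) = J[i]

/-- `J` is the repeating block of the sequence `a`: for some initial block, `a` is that block
followed by infinitely many copies of `J`, there is no shorter such block, and the initial block
does not end with a copy of `J`. -/
def IsRepeatingBlock (a : ℕ → ℕ+) (J : List ℕ+) : Prop :=
  ∃ m, IsPeriodicWith a m J ∧ (∀ m' J', IsPeriodicWith a m' J' → J.length ≤ J'.length) ∧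
    ¬ J <:+ m

/-- Modular equivalence: `x = (a y + b)/(c y + d)` with integers such that `a d - b c = ±1`. -/
def ModularEquiv (x y : ℝ) : Prop :=
  ∃ a b c d : ℤ, (a * d - b * c = 1 ∨ a * d - b * c = -1) ∧
    x = ((a : ℝ) * y + b) / ((c : ℝ) * y + d)

theorem denom_ne_zero {y : ℝ} (hy : Irrational y) {c d : ℤ} (h : c ≠ 0 ∨ d ≠ 0) :
    (c : ℝ) * y + d ≠ 0 := by
  rcases eq_or_ne c 0 with rfl | hc
  · simpa using h
  · exact ((hy.intCast_mul hc).add_intCast d).ne_zero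

theorem denom_ne_zero_of_det {y : ℝ} (hy : Irrational y) {a b c d : ℤ}
    (h : a * d - b * c = 1 ∨ a * d - b * c = -1) : (c : ℝ) * y + d ≠ 0 := by
  apply denom_ne_zero hy
  by_contra! h'
  obtain ⟨rfl, rfl⟩ := h'
  simp at h

theorem ModularEquiv.symm {x y : ℝ} (hx : Irrational x) (hy : Irrational y)
    (h : ModularEquiv x y) : ModularEquiv y x := by
  obtain ⟨a, b, c, d, hdet, hxy⟩ := h
  have h1 := denom_ne_zero_of_det hy hdet
  have hdet' : d * a - (-b) * (-c) = 1 ∨ d * a - (-b) * (-c) = -1 := by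
    rcases hdet with h | h
    · left; linarith
    · right; linarith
  refine ⟨d, -b, -c, a, hdet', ?_⟩
  have h2 := denom_ne_zero_of_det hx hdet'
  rw [eq_div_iff h1] at hxy
  rw [eq_div_iff h2]
  push_cast
  linarith

theorem ModularEquiv.trans {x y z : ℝ} (hy : Irrational y) (hz : Irrational z)
    (h : ModularEquiv x y) (h' : ModularEquiv y z) : ModularEquiv x z := by
  obtain ⟨a, b, c, d, hdet, hxy⟩ := h
  obtain ⟨a', b', c', d', hdet', hyz⟩ := h'
  have e : (a * a' + b * c') * (c * b' + d * d') - (a * b' + b * d') * (c * a' + d * c') =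
      (a * d - b * c) * (a' * d' - b' * c') := by ring
  have hdet'' : (a * a' + b * c') * (c * b' + d * d') - (a * b' + b * d') * (c * a' + d * c') = 1 ∨
      (a * a' + b * c') * (c * b' + d * d') - (a * b' + b * d') * (c * a' + d * c') = -1 := by
    rw [e]
    rcases hdet with h | h <;> rcases hdet' with h' | h' <;> simp [h, h']
  refine ⟨_, _, _, _, hdet'', ?_⟩
  have h1 := denom_ne_zero_of_det hz hdet'
  have h2 := denom_ne_zero_of_det hy hdet
  have h3 := denom_ne_zero_of_det hz hdet''
  rw [eq_div_iff h1] at hyz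
  rw [eq_div_iff h2] at hxy
  rw [eq_div_iff h3]
  push_cast
  linear_combination ((c' : ℝ) * z + d') * hxy + (a - c * x) * hyz

/-- Modular equivalence on `Ω`. -/
instance omegaSetoid : Setoid Omega where
  r x y := ModularEquiv x y
  iseqv :=
    { refl := fun x => ⟨1, 0, 0, 1, by simp, by simp⟩
      symm := fun {x y} h => ModularEquiv.symm x.2.2 y.2.2 h
      trans := fun {_ y z} h h' => ModularEquiv.trans y.2.2 z.2.2 h h' }

/-! ## The representation `π_α` -/

/-- The Hilbert space `l₂(Ω)`. -/
abbrev L2Omega : Type := ℓ²(Omega, ℂ)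

/-- The standard basis vector `e_x`. -/
def stdBasis (x : Omega) : L2Omega := by
  classical exact lp.single 2 x 1

theorem orthonormal_stdBasis : Orthonormal ℂ stdBasis := by
  classical
  rw [orthonormal_iff_ite]
  intro x y
  simp only [stdBasis, lp.inner_single_left, lp.single_apply]
  by_cases h : x = y <;> simp [h]

instance : Nontrivial L2Omega :=
  ⟨⟨stdBasis (Classical.arbitrary _), 0, fun h => by
    simpa [h] using orthonormal_stdBasis.1 (Classical.arbitrary _)⟩⟩

/-- The map `α_i(x) = 1/(x + i)` from `Ω` to `Ω`. -/
def alpha (i : ℕ+) (x : Omega) : Omega :=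
  ⟨1 / ((x : ℝ) + (i : ℕ)), by
    have hi : (1 : ℝ) ≤ (i : ℕ) := by exact_mod_cast i.2
    have hx := (omega_pos x)
    refine ⟨⟨by positivity, ?_⟩, ?_⟩
    · rw [div_le_one (by positivity)]; linarith
    · rw [one_div]; exact irrational_inv_iff.2 (x.2.2.add_natCast _)⟩

theorem alpha_eq_iff {i j : ℕ+} {x y : Omega} : alpha i x = alpha j y ↔ i = j ∧ x = y := by
  refine ⟨fun h => ?_, fun h => by rw [h.1, h.2]⟩
  have h' := congrArg Subtype.val h
  simp only [alpha] at h'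
  obtain ⟨h1, h2⟩ := cf_head_unique (alpha i x).2.2 x.2.1 y.2.1
    (show ((alpha i x : Omega) : ℝ) = 1 / ((i : ℝ) + x) by simp [alpha, add_comm])
    (show ((alpha i x : Omega) : ℝ) = 1 / ((j : ℝ) + y) by rw [h]; simp [alpha, add_comm])
  exact ⟨h1, Subtype.ext h2⟩

theorem orthonormal_stdBasis_alpha (i : ℕ+) : Orthonormal ℂ fun x => stdBasis (alpha i x) :=
  orthonormal_stdBasis.comp _ fun _ _ h => (alpha_eq_iff.1 h).2

/-- The isometry of `l₂(Ω)` with `e_x ↦ e_{α_i(x)}`. -/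
def alphaOp (i : ℕ+) : L2Omega →L[ℂ] L2Omega :=
  (orthonormal_stdBasis_alpha i).orthogonalFamily.linearIsometry.toContinuousLinearMap

theorem alphaOp_stdBasis (i : ℕ+) (x : Omega) : alphaOp i (stdBasis x) = stdBasis (alpha i x) := by
  classical
  have h := (orthonormal_stdBasis_alpha i).orthogonalFamily.linearIsometry_apply_single
    (i := x) (1 : ℂ)
  simp only [LinearIsometry.toSpanSingleton_apply, one_smul] at h
  refine Eq.trans ?_ h
  simp only [alphaOp, stdBasis, LinearIsometry.coe_toContinuousLinearMap]

theorem inner_stdBasis (x : Omega) (v : L2Omega) : inner ℂ (stdBasis x) v = v x := by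
  classical
  simp [stdBasis, lp.inner_single_left]

theorem ext_stdBasis {S T : L2Omega →L[ℂ] L2Omega} (h : ∀ x, S (stdBasis x) = T (stdBasis x)) :
    S = T := by
  classical
  refine lp.ext_continuousLinearMap (by simp) fun x => ?_
  ext1
  simpa [stdBasis] using h x

theorem isCuntzFamily_alphaOp : IsCuntzFamily alphaOp := by
  classical
  refine IsCuntzFamily.of_star_mul fun i j => ext_stdBasis fun x => lp.ext (funext fun y => ?_)
  rw [← inner_stdBasis, ← inner_stdBasis, ContinuousLinearMap.star_eq_adjoint,
    ContinuousLinearMap.mul_def, ContinuousLinearMap.comp_apply, ContinuousLinearMap.adjoint_inner_right, alphaOp_stdBasis,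
    alphaOp_stdBasis, orthonormal_iff_ite.1 orthonormal_stdBasis]
  by_cases hij : i = j
  · simp [hij, alpha_eq_iff, orthonormal_iff_ite.1 orthonormal_stdBasis]
  · simp [hij, alpha_eq_iff]

/-- The representation `π_α` of `O_∞` on `l₂(Ω)`, with `π_α(s_i) e_x = e_{α_i(x)}`. -/
def piAlpha : CuntzAlgebra →⋆ₐ[ℂ] (L2Omega →L[ℂ] L2Omega) :=
  cuntzLift alphaOp isCuntzFamily_alphaOp

theorem piAlpha_cuntzGen_stdBasis (i : ℕ+) (x : Omega) :
    piAlpha (cuntzGen i) (stdBasis x) = stdBasis (alpha i x) := alphaOp_stdBasis i x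

/-- The closed subspace `H_[x]` of `l₂(Ω)` generated by `e_y`, `y ∈ [x]`. -/
abbrev classSubspace (q : Quotient omegaSetoid) : Submodule ℂ L2Omega :=
  (Submodule.span ℂ (stdBasis '' {y | Quotient.mk omegaSetoid y = q})).topologicalClosure

/-- The subrepresentation `η_[x]` of `π_α` on `H_[x]`. -/
def eta (hinv : ∀ q, IsInvariantSubspace piAlpha (classSubspace q)) (q : Quotient omegaSetoid) :
    CuntzAlgebra →⋆ₐ[ℂ] (classSubspace q →L[ℂ] classSubspace q) :=
  subrep piAlpha (classSubspace q) (hinv q)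

end

noncomputable section

/-! ## The Gauss map as a shift of digits -/

/-! Each `alpha i` puts the digit `i` in front of a continued fraction and the Gauss map removes the
first digit. Digits therefore identify `Omega` with all sequences in `ℕ+`, and the generators act on
basis vectors as the inverse branches of the shift. Serret's theorem (`apply_irrFract_eq_of_det`)
says that whatever is invariant under all `alpha i` is constant on modular classes.

For (i) and (ii): two distinct points differ in some digit, so words in the generators separate the
vectors `stdBasis x`, and every operator commuting with `piAlpha` is diagonal
(`exists_eq_smul_of_commute`). The projection onto an invariant subspace thus keeps or kills each
basis vector, and by Serret's theorem the choice depends only on the modular class. An intertwiner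
of two subrepresentations, extended by zero, is diagonal as well, so equivalent subrepresentations
contain the same basis vectors and coincide.

For (iii): adjoints of words move `stdBasis x` along the Gauss orbit of `x`. A coincidence in the
orbit makes a tail a fixed point of an integral Möbius map, hence quadratic. Conversely
(`IsQuadratic.exists_iterate_eq`, Lagrange) the Gauss map preserves the discriminant and eventually
makes the conjugate root negative, which leaves finitely many polynomials, so the orbit is finite.

For (iv): the generators act on the basis by a branching system, and reading letters as digits maps
it to that of the `alpha i`. If this code is injective, it yields an isometric intertwiner whose
range is one of the class subspaces. Injectivity comes from irreducibility
(`RealizesBranching.not_shift_iterate_eq`): two basis points with equal letters would produce a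
translation by a period, an isometry in the commutant with indefinite real part. -/

theorem gaussMap_alpha (i : ℕ+) (x : Omega) : gaussMap (alpha i x) = x := by
  have hx := omega_pos x
  have hfl : ⌊(x : ℝ) + (i : ℕ)⌋₊ = i := by
    rw [Nat.floor_add_natCast hx.le, Nat.floor_eq_zero.2 (omega_lt_one x), zero_add]
  refine Subtype.ext ?_
  simp [gaussMap, alpha, hfl]

/-- The first continued fraction digit. -/
def firstDigit (x : Omega) : ℕ+ := ⟨⌊(x : ℝ)⁻¹⌋₊, omega_floor_pos x⟩

theorem alpha_firstDigit (x : Omega) : alpha (firstDigit x) (gaussMap x) = x := by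
  refine Subtype.ext ?_
  simp [gaussMap, alpha, firstDigit]

theorem firstDigit_alpha (i : ℕ+) (x : Omega) : firstDigit (alpha i x) = i :=
  (alpha_eq_iff.1 (alpha_firstDigit (alpha i x))).1

theorem cfe_zero (x : Omega) : cfe x 0 = firstDigit x := by
  have h1 := isCFE_tail (isCFE_cfe x) (omega_pos x)
  refine (cf_head_unique x.2.2 h1.mem (gaussMap x).2.1 (by simp) ?_).1
  simp [gaussMap, firstDigit]

theorem cfe_gaussMap (x : Omega) : cfe (gaussMap x) = fun n => cfe x (n + 1) := by
  have h1 := isCFE_tail (isCFE_cfe x) (omega_pos x)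
  refine IsCFE.unique (gaussMap x).2.2 (isCFE_cfe _) ?_
  convert h1 using 1
  rw [cfe_zero]
  simp [gaussMap, firstDigit]

theorem cfe_iterate (x : Omega) (m n : ℕ) : cfe (gaussMap^[m] x) n = cfe x (m + n) := by
  induction m generalizing x with
  | zero => simp
  | succ m ih =>
    rw [Function.iterate_succ_apply, ih, cfe_gaussMap]
    exact congrArg _ (by omega)

theorem alpha_cfe_gaussMap (x : Omega) : alpha (cfe x 0) (gaussMap x) = x := by
  rw [cfe_zero, alpha_firstDigit]

theorem cfe_alpha_zero (i : ℕ+) (x : Omega) : cfe (alpha i x) 0 = i := by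
  rw [cfe_zero, firstDigit_alpha]

theorem cfe_injective : Function.Injective cfe := by
  intro x y h
  have hx := isCFE_cfe x
  rw [h] at hx
  exact Subtype.ext (tendsto_nhds_unique hx (isCFE_cfe y))

/-- The composition `α_{i₁} ∘ ⋯ ∘ α_{iₙ}` for a word `(i₁, …, iₙ)`. -/
def alphaWord (w : List ℕ+) (x : Omega) : Omega := w.foldr alpha x

theorem alphaWord_iterate (w : List ℕ+) (x : Omega)
    (h : ∀ (i : ℕ) (hi : i < w.length), cfe x i = w[i]) :
    alphaWord w (gaussMap^[w.length] x) = x := by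
  induction w generalizing x with
  | nil => rfl
  | cons i w ih =>
    have h0 : cfe x 0 = i := h 0 (by simp)
    have h1 := ih (gaussMap x) fun k hk => by
      rw [cfe_gaussMap]
      exact h (k + 1) (by simpa using hk)
    change alpha i (alphaWord w (gaussMap^[w.length] (gaussMap x))) = x
    rw [h1, ← h0, alpha_cfe_gaussMap]

/-- An invariant of all `alpha i` is one of the Gauss map, since `x` is an `alpha`-image of
`gaussMap x`. It serves for the class map and, with values in `Prop`, for predicates; hence the
equalities of propositions below. -/
theorem apply_iterate_gaussMap {β : Sort*} {c : Omega → β} (hc : ∀ i x, c (alpha i x) = c x)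
    (n : ℕ) (x : Omega) : c (gaussMap^[n] x) = c x := by
  induction n generalizing x with
  | zero => rfl
  | succ n ih =>
    rw [Function.iterate_succ_apply, ih]
    conv_rhs => rw [← alpha_cfe_gaussMap x, hc]

/-! ## The point with given digits -/

theorem exists_cfEval_limit (a : ℕ → ℕ+) : ∃ x : ℝ, IsCFE x a := by
  have h0 : Filter.Tendsto (fun n : ℕ => 2 * (1 / 2 : ℝ) ^ n) Filter.atTop (𝓝 0) := by
    simpa using (tendsto_pow_atTop_nhds_zero_of_lt_one (by norm_num : (0 : ℝ) ≤ 1 / 2)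
      (by norm_num)).const_mul 2
  -- The later digits only enter as an end value in `[0, 1]`, so the first `N` digits fix every
  -- later convergent up to `2 * (1 / 2) ^ N`.
  have key : ∀ (n k : ℕ) (a : ℕ → ℕ+),
      cfEval (List.ofFn fun l : Fin (n + k) => a l) 0 =
        cfEval (List.ofFn fun l : Fin n => a l)
          (cfEval (List.ofFn fun l : Fin k => a (n + l)) 0) := by
    intro n k
    induction n with
    | zero => intro a; simp [cfEval]
    | succ n ih =>
      intro a
      have e : n + 1 + k = n + k + 1 := by omega
      have h := ih fun l => a (l + 1)
      rw [e, cfEval_ofFn_succ, cfEval_ofFn_succ, h]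
      simp only [Nat.add_right_comm]
  refine cauchySeq_tendsto_of_complete (cauchySeq_of_le_tendsto_0
    (fun N => 2 * (1 / 2 : ℝ) ^ N * 2) (fun n m N hn hm => ?_)
    (by simpa only [zero_mul] using h0.mul_const 2))
  have hb : ∀ n, N ≤ n → |cfEval (List.ofFn fun l : Fin n => a l) 0 -
      cfEval (List.ofFn fun l : Fin N => a l) 0| ≤ 2 * (1 / 2) ^ N := by
    intro n hn
    obtain ⟨k, rfl⟩ := Nat.exists_eq_add_of_le hn
    rw [key]
    simpa using abs_cfEval_sub_le (List.ofFn fun l : Fin N => a l)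
      (cfEval_mem (List.ofFn fun l : Fin k => a (N + l)) (y := 0) (by simp)) (z := 0) (by simp)
  have h1 := hb n hn
  have h2 := hb m hm
  rw [Real.dist_eq]
  rw [abs_le] at h1 h2 ⊢
  constructor <;> linarith

/-- The limit of the convergents with digits `a`. -/
def cfLimit (a : ℕ → ℕ+) : ℝ := (exists_cfEval_limit a).choose

theorem isCFE_cfLimit (a : ℕ → ℕ+) : IsCFE (cfLimit a) a := (exists_cfEval_limit a).choose_spec

theorem cfLimit_eq (a : ℕ → ℕ+) : cfLimit a = 1 / ((a 0 : ℝ) + cfLimit fun n => a (n + 1)) := by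
  have h := isCFE_cfLimit fun n => a (n + 1)
  have ha : (1 : ℝ) ≤ a 0 := by exact_mod_cast (a 0).2
  have h1 : Filter.Tendsto (fun n : ℕ => cfEval (List.ofFn fun l : Fin (n + 1) => a l) 0)
      Filter.atTop (𝓝 (1 / ((a 0 : ℝ) + cfLimit fun n => a (n + 1)))) := by
    simp only [cfEval_ofFn_succ]
    refine (tendsto_const_nhds.div (h.const_add _) ?_)
    have := h.mem.1
    positivity
  exact tendsto_nhds_unique ((Filter.tendsto_add_atTop_iff_nat 1).2 (isCFE_cfLimit a)) h1

theorem cfLimit_pos (a : ℕ → ℕ+) : 0 < cfLimit a := by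
  have h := (isCFE_cfLimit fun n => a (n + 1)).mem.1
  have ha : (1 : ℝ) ≤ a 0 := by exact_mod_cast (a 0).2
  rw [cfLimit_eq]
  positivity

/-- Infinite descent on the denominator: if the limit is `p / q`, then `p < q` and the limit of the
tail is `(q - a 0 * p) / p`. -/
theorem irrational_cfLimit (a : ℕ → ℕ+) : Irrational (cfLimit a) := by
  have key : ∀ (q : ℕ) (a : ℕ → ℕ+) (p : ℤ), 0 < q → cfLimit a ≠ p / q := by
    intro q
    induction q using Nat.strong_induction_on with
    | _ q ih =>
      intro a p hq h
      have hq' : (0 : ℝ) < q := by exact_mod_cast hq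
      set y := cfLimit fun n => a (n + 1) with hy
      have hy0 : 0 < y := cfLimit_pos _
      have ha : (1 : ℝ) ≤ a 0 := by exact_mod_cast (a 0).2
      have hp0 : (0 : ℝ) < p := by
        have := cfLimit_pos a
        rw [h] at this
        exact (div_pos_iff_of_pos_right hq').1 this
      rw [cfLimit_eq, ← hy, div_eq_div_iff (by positivity) hq'.ne'] at h
      have hlt : (p : ℝ) < q := by nlinarith
      lift p to ℕ using by exact_mod_cast hp0.le
      refine ih p (by exact_mod_cast hlt) (fun n => a (n + 1)) ((q : ℤ) - (a 0 : ℕ) * p)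
        (by exact_mod_cast hp0) ?_
      push_cast at h hp0 ⊢
      rw [← hy, eq_div_iff hp0.ne']
      linarith
  rintro ⟨r, hr⟩
  refine key r.den a r.num r.pos ?_
  rw [← hr]
  exact_mod_cast (Rat.num_div_den r).symm

/-- The point of `Ω` with digits `a`. -/
def ofDigits (a : ℕ → ℕ+) : Omega := ⟨cfLimit a, (isCFE_cfLimit a).mem, irrational_cfLimit a⟩

theorem alpha_ofDigits (a : ℕ → ℕ+) : alpha (a 0) (ofDigits fun n => a (n + 1)) = ofDigits a := by
  refine Subtype.ext ?_
  simp only [alpha, ofDigits]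
  rw [cfLimit_eq a, add_comm]

theorem cfe_ofDigits (a : ℕ → ℕ+) : cfe (ofDigits a) = a :=
  IsCFE.unique (ofDigits a).2.2 (isCFE_cfe _) (isCFE_cfLimit a)

/-! ## Modular equivalence and the maps `α_i` -/

theorem modularEquiv_alpha (i : ℕ+) (x : Omega) : ModularEquiv (alpha i x : Omega) x :=
  ⟨0, 1, 1, (i : ℕ), by simp, by simp [alpha]⟩

theorem mk_alpha (i : ℕ+) (x : Omega) :
    Quotient.mk omegaSetoid (alpha i x) = Quotient.mk omegaSetoid x :=
  Quotient.sound (modularEquiv_alpha i x)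

/-- The fractional part of an irrational number. -/
def irrFract (x : ℝ) (hx : Irrational x) : Omega :=
  ⟨Int.fract x, ⟨Int.fract_nonneg x, (Int.fract_lt_one x).le⟩, hx.sub_intCast _⟩

theorem irrFract_coe (x : Omega) : irrFract x x.2.2 = x :=
  Subtype.ext (Int.fract_eq_self.2 ⟨x.2.1.1, omega_lt_one x⟩)

theorem alpha_eq_of_inv_eq {x z : Omega} {i : ℕ+} (h : (x : ℝ)⁻¹ = z + (i : ℕ)) :
    alpha i z = x :=
  Subtype.ext (by simp [alpha, ← h])

/-- For `x = 1/(d + g)` with `d ≥ 2` one has `1 - x = 1/(1 + 1/((d - 1) + g))`, so `x` and `1 - x`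
share the tail `g`. -/
theorem apply_one_sub_of_lt_half {β : Sort*} {c : Omega → β} (hc : ∀ i x, c (alpha i x) = c x)
    {x y : Omega} (h : (y : ℝ) = 1 - x) (hx : (x : ℝ) < 1 / 2) : c y = c x := by
  have h0 := omega_pos x
  have hi := omega_pos (gaussMap x)
  have hi1 := omega_lt_one (gaussMap x)
  have hd : (x : ℝ)⁻¹ = gaussMap x + (firstDigit x : ℕ) := by
    simp [gaussMap, firstDigit]
  have h2 : (2 : ℝ) < (x : ℝ)⁻¹ := by
    rw [lt_inv_comm₀ (by norm_num) h0]; linarith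
  have h1 : 1 < (firstDigit x : ℕ) := by
    have : (1 : ℝ) < (firstDigit x : ℕ) := by linarith
    exact_mod_cast this
  let i : ℕ+ := ⟨(firstDigit x : ℕ) - 1, by omega⟩
  have hiv : ((i : ℕ) : ℝ) = (firstDigit x : ℕ) - 1 := by
    change (((firstDigit x : ℕ) - 1 : ℕ) : ℝ) = _
    rw [Nat.cast_sub h1.le, Nat.cast_one]
  have hy : alpha 1 (alpha i (gaussMap x)) = y := by
    refine alpha_eq_of_inv_eq ?_
    simp only [alpha, hiv, h, PNat.one_coe, Nat.cast_one]
    have h3 : (gaussMap x : ℝ) + ((firstDigit x : ℕ) - 1) = (1 - x) / x := by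
      rw [← add_sub_assoc, ← hd]; field_simp
    rw [h3]
    have : (1 : ℝ) - x ≠ 0 := by linarith
    field_simp
    ring
  rw [← hy, hc, hc]
  exact apply_iterate_gaussMap hc 1 x

theorem apply_one_sub {β : Sort*} {c : Omega → β} (hc : ∀ i x, c (alpha i x) = c x)
    {x y : Omega} (h : (y : ℝ) = 1 - x) : c y = c x := by
  rcases lt_trichotomy (x : ℝ) (1 / 2) with h1 | h1 | h1
  · exact apply_one_sub_of_lt_half hc h h1
  · exact absurd ⟨1 / 2, by rw [h1]; norm_num⟩ x.2.2
  · exact (apply_one_sub_of_lt_half hc (x := y) (y := x) (by linarith) (by linarith)).symm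

theorem apply_irrFract_neg {β : Sort*} {c : Omega → β} (hc : ∀ i x, c (alpha i x) = c x)
    {x : ℝ} (hx : Irrational x) : c (irrFract (-x) hx.neg) = c (irrFract x hx) :=
  apply_one_sub hc (Int.fract_neg (irrFract x hx).2.2.ne_zero)

/-- On `(0, 1)` the fractional part of `1/x` is the Gauss map. For `x > 1` the same fact is used at
`1/x`, and negative `x` reduce to positive ones by `apply_irrFract_neg`. -/
theorem apply_irrFract_inv {β : Sort*} {c : Omega → β} (hc : ∀ i x, c (alpha i x) = c x)
    {x : ℝ} (hx : Irrational x) :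
    c (irrFract x⁻¹ (irrational_inv_iff.2 hx)) = c (irrFract x hx) := by
  have below : ∀ x : Omega, c (irrFract (x : ℝ)⁻¹ (irrational_inv_iff.2 x.2.2)) = c x := by
    intro x
    rw [← apply_iterate_gaussMap hc 1 x]
    congr 1
    refine Subtype.ext ?_
    simp only [irrFract, gaussMap, Function.iterate_one, Int.fract]
    rw [natCast_floor_eq_intCast_floor (inv_nonneg.2 x.2.1.1)]
  have pos : ∀ (x : ℝ) (hx : Irrational x), 0 < x →
      c (irrFract x⁻¹ (irrational_inv_iff.2 hx)) = c (irrFract x hx) := by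
    intro x hx h0
    rcases le_or_gt x 1 with h1 | h1
    · have h := below ⟨x, ⟨h0.le, h1⟩, hx⟩
      exact h.trans (congrArg c (irrFract_coe ⟨x, ⟨h0.le, h1⟩, hx⟩)).symm
    · let y : Omega := ⟨x⁻¹, ⟨inv_nonneg.2 h0.le, inv_le_one_of_one_le₀ h1.le⟩,
        irrational_inv_iff.2 hx⟩
      have h := below y
      have hy : irrFract x⁻¹ (irrational_inv_iff.2 hx) = y := irrFract_coe y
      simp only [y, inv_inv] at h
      rw [hy]
      exact h.symm
  rcases lt_or_gt_of_ne hx.ne_zero with h0 | h0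
  · have h := pos (-x) hx.neg (by linarith)
    rw [apply_irrFract_neg hc hx] at h
    rw [← h, ← apply_irrFract_neg hc (irrational_inv_iff.2 hx)]
    simp only [inv_neg]
  · exact pos x hx h0

theorem irrFract_add_int {x : ℝ} (hx : Irrational x) (n : ℤ) :
    irrFract (x + n) (hx.add_intCast n) = irrFract x hx :=
  Subtype.ext (Int.fract_add_intCast x n)

/-- Serret's theorem: a function on `Ω` that is invariant under all maps `α_i`, extended to the
irrational numbers by periodicity, is invariant under modular transformations. -/
theorem apply_irrFract_eq_of_det {β : Sort*} {f : Omega → β}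
    (hf : ∀ i x, f (alpha i x) = f x) {y : ℝ} (hy : Irrational y) :
    ∀ (n : ℕ) (a b c d : ℤ) (x : ℝ) (hx : Irrational x), c.natAbs = n →
      (a * d - b * c = 1 ∨ a * d - b * c = -1) → x = ((a : ℝ) * y + b) / ((c : ℝ) * y + d) →
      f (irrFract x hx) = f (irrFract y hy) := by
  intro n
  induction n using Nat.strong_induction_on with
  | _ n ih =>
    intro a b c d x hx hn hdet hxy
    rcases eq_or_ne c 0 with rfl | hc
    -- With `c = 0` the determinant forces `a` and `d` to be units, so `x` is `±y` plus an integer.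
    · have had : a * d = 1 ∨ a * d = -1 := by simpa using hdet
      have hd : d = 1 ∨ d = -1 := by
        rcases had with h | h
        · exact Int.isUnit_iff.1 (isUnit_of_dvd_one ⟨a, by linarith⟩)
        · exact Int.isUnit_iff.1 (isUnit_of_dvd_one ⟨-a, by linarith⟩)
      have ha : a = 1 ∨ a = -1 := by
        rcases hd with rfl | rfl <;> rcases had with h | h <;> omega
      have hx' : ∃ m : ℤ, x = y + m ∨ x = -y + m := by
        rcases hd with rfl | rfl <;> rcases ha with rfl | rfl
        · exact ⟨b, Or.inl (by rw [hxy]; push_cast; ring)⟩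
        · exact ⟨b, Or.inr (by rw [hxy]; push_cast; ring)⟩
        · exact ⟨-b, Or.inr (by rw [hxy]; push_cast; ring)⟩
        · exact ⟨-b, Or.inl (by rw [hxy]; push_cast; ring)⟩
      obtain ⟨m, rfl | rfl⟩ := hx'
      · rw [irrFract_add_int hy]
      · rw [irrFract_add_int hy.neg, apply_irrFract_neg hf hy]
    · have hden := denom_ne_zero_of_det hy hdet
      -- Euclidean step: subtracting `q` from `x` replaces `a` by `a % c`, and inverting exchanges
      -- the rows, so the lower left entry becomes `a % c`, smaller than `c` in absolute value. Both
      -- moves preserve `f`.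
      set q := a / c with hq
      have hr : a % c = a - c * q := by rw [hq, Int.emod_def]
      have hlt : (a % c).natAbs < n := by
        have h1 := Int.emod_nonneg a hc
        have h2 := Int.emod_lt_abs a hc
        rw [Int.abs_eq_natAbs] at h2
        omega
      have hx1 : Irrational (x + ((-q : ℤ) : ℝ)) := hx.add_intCast _
      have hdet' : c * (b - q * d) - d * (a % c) = 1 ∨ c * (b - q * d) - d * (a % c) = -1 := by
        rw [hr]
        rcases hdet with h | h
        · right; linarith
        · left; linarith
      have h := ih _ hlt c d (a % c) (b - q * d) (x + ((-q : ℤ) : ℝ))⁻¹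
        (irrational_inv_iff.2 hx1) rfl hdet' ?_
      · rw [← h, apply_irrFract_inv hf hx1, irrFract_add_int hx]
      · rw [hr, ← inv_div]
        congr 1
        rw [eq_div_iff hden] at hxy ⊢
        push_cast
        linear_combination hxy

theorem apply_eq_of_modularEquiv {β : Sort*} {c : Omega → β} (hc : ∀ i x, c (alpha i x) = c x)
    {x y : Omega} (h : ModularEquiv x y) : c x = c y := by
  obtain ⟨a, b, c', d, hdet, hxy⟩ := h
  have := apply_irrFract_eq_of_det hc y.2.2 _ a b c' d x x.2.2 rfl hdet hxy
  rwa [irrFract_coe, irrFract_coe] at this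

/-! ## Quadratic irrationals and periodic expansions -/

theorem coe_alpha_mul (i : ℕ+) (z : Omega) : (alpha i z : ℝ) * (z + (i : ℕ)) = 1 := by
  have hz := omega_pos z
  simp only [alpha]
  field_simp

theorem isQuadratic_of_alpha {i : ℕ+} {z : Omega} (h : IsQuadratic (alpha i z)) :
    IsQuadratic z := by
  obtain ⟨a, b, c, ha, h⟩ := h
  have hm := coe_alpha_mul i z
  have hirr := (alpha i z).2.2
  set x := (alpha i z).1
  -- Coefficients of `a + b(z + i) + c(z + i)²`. If the leading one vanished, `x` would be a root of
  -- a linear polynomial.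
  refine ⟨c, b + 2 * c * (i : ℕ), a + b * (i : ℕ) + c * (i : ℕ) ^ 2, ?_, ?_⟩
  · rintro rfl
    refine denom_ne_zero hirr (c := a) (d := b) (Or.inl ha) ?_
    refine (mul_eq_zero.1 (?_ : x * (a * x + b) = 0)).resolve_left hirr.ne_zero
    push_cast at h
    linear_combination h
  · refine (mul_eq_zero.1 (?_ : x ^ 2 * _ = 0)).resolve_left (pow_ne_zero 2 hirr.ne_zero)
    push_cast
    linear_combination (b * x + c * (x * (z + (i : ℕ)) + 1)) * hm + h

theorem IsQuadratic.alpha {i : ℕ+} {z : Omega} (h : IsQuadratic z) : IsQuadratic (alpha i z) := by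
  obtain ⟨a, b, c, ha, h⟩ := h
  have hm := coe_alpha_mul i z
  have hirr := (_root_.alpha i z).2.2
  set x := (_root_.alpha i z).1
  have key : (a : ℝ) * (1 - (i : ℕ) * x) ^ 2 + b * x * (1 - (i : ℕ) * x) + c * x ^ 2 = 0 := by
    have hx : 1 - (i : ℕ) * x = x * z := by linear_combination -hm
    rw [hx]
    linear_combination x ^ 2 * h
  refine ⟨a * (i : ℕ) ^ 2 - b * (i : ℕ) + c, b - 2 * a * (i : ℕ), a, fun h0 => ?_, ?_⟩
  · refine denom_ne_zero hirr (c := b - 2 * a * (i : ℕ)) (d := a) (Or.inr ha) ?_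
    have h0' : (a : ℝ) * (i : ℕ) ^ 2 - b * (i : ℕ) + c = 0 := by exact_mod_cast h0
    push_cast
    linear_combination key - x ^ 2 * h0'
  · push_cast
    linear_combination key

theorem isQuadratic_alpha_iff (i : ℕ+) (z : Omega) : IsQuadratic (alpha i z) = IsQuadratic z :=
  propext ⟨isQuadratic_of_alpha, IsQuadratic.alpha⟩

/-- A word acts as an integral Möbius map. The sign conditions make the induction yield `0 < r` for
nonempty words, so that the fixed point equation is truly quadratic. -/
theorem exists_moebius_alphaWord (w : List ℕ+) (z : Omega) :
    ∃ p q r s : ℤ, 0 ≤ p ∧ 0 ≤ r ∧ 0 < p + r ∧ (w ≠ [] → 0 < r) ∧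
      (alphaWord w z : ℝ) * (r * z + s) = p * z + q := by
  induction w with
  | nil => exact ⟨1, 0, 0, 1, by simp, by simp, by simp, by simp, by simp [alphaWord]⟩
  | cons i w ih =>
    obtain ⟨p, q, r, s, hp, hr, hpr, -, h⟩ := ih
    have hi : (1 : ℤ) ≤ (i : ℕ) := by exact_mod_cast i.2
    have hpos : 0 < (i : ℕ) * r + p := by nlinarith
    refine ⟨r, s, (i : ℕ) * r + p, (i : ℕ) * s + q, hr, hpos.le, by linarith, fun _ => hpos, ?_⟩
    have hm := coe_alpha_mul i (alphaWord w z)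
    change (alpha i (alphaWord w z) : ℝ) * _ = _
    push_cast
    linear_combination (r * (z : ℝ) + s) * hm - (alpha i (alphaWord w z) : ℝ) * h

theorem isQuadratic_of_iterate_eq {x : Omega} {k : ℕ} (hk : 0 < k)
    (h : gaussMap^[k] x = x) : IsQuadratic x := by
  set w := List.ofFn fun l : Fin k => cfe x l with hw
  have hx : alphaWord w (gaussMap^[w.length] x) = x :=
    alphaWord_iterate w x fun i hi => by simp [hw]
  rw [show w.length = k by simp [hw], h] at hx
  obtain ⟨p, q, r, s, -, -, -, hr, h⟩ := exists_moebius_alphaWord w x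
  rw [hx] at h
  have hne : w ≠ [] := by
    rw [Ne, ← List.length_eq_zero_iff]
    simp [hw, hk.ne']
  exact ⟨r, s - p, -q, (hr hne).ne', by push_cast; linear_combination h⟩

theorem iterate_gaussMap_injective {x : Omega} (hx : ¬ IsQuadratic x) :
    Function.Injective fun n => gaussMap^[n] x := by
  have key : ∀ m n, m < n → gaussMap^[m] x ≠ gaussMap^[n] x := by
    intro m n hmn h
    apply hx
    rw [← apply_iterate_gaussMap isQuadratic_alpha_iff m x]
    refine isQuadratic_of_iterate_eq (k := n - m) (by omega) ?_
    rw [← Function.iterate_add_apply, Nat.sub_add_cancel hmn.le, h]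
  intro m n h
  rcases lt_trichotomy m n with h1 | h1 | h1
  · exact absurd h (key _ _ h1)
  · exact h1
  · exact absurd h.symm (key _ _ h1)

/-- `z` and `z'` are the two roots of an integral quadratic polynomial with discriminant `D`. -/
def AreConjugate (D : ℤ) (z : Omega) (z' : ℝ) : Prop :=
  (z : ℝ) ≠ z' ∧ Irrational z' ∧ ∃ A B C : ℤ, A ≠ 0 ∧ (A : ℝ) * (z : ℝ) ^ 2 + B * z + C = 0 ∧
    (A : ℝ) * z' ^ 2 + B * z' + C = 0 ∧ B ^ 2 - 4 * A * C = D

theorem IsQuadratic.exists_areConjugate {x : Omega} (h : IsQuadratic x) :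
    ∃ D x', AreConjugate D x x' := by
  obtain ⟨a, b, c, ha, h⟩ := h
  have ha' : (a : ℝ) ≠ 0 := by exact_mod_cast ha
  have hx' : (a : ℝ) * (-(x : ℝ) - b / a) = -(a * x + b) := by field_simp; ring
  -- The second root is read off from the sum of the roots; it differs from `x` because `2ax + b ≠
  -- 0`.
  refine ⟨_, -(x : ℝ) - b / a, fun h' => ?_, ?_, a, b, c, ha, h, ?_, rfl⟩
  · refine denom_ne_zero x.2.2 (c := 2 * a) (d := b) (Or.inl (by simpa using ha)) ?_
    rw [← h'] at hx'
    push_cast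
    linarith
  · have := x.2.2.neg.sub_ratCast (b / a)
    push_cast at this
    exact this
  · linear_combination h + (-(x : ℝ) - b / a) * hx' - (x : ℝ) * hx'

theorem coe_gaussMap (z : Omega) : (gaussMap z : ℝ) = (z : ℝ)⁻¹ - (firstDigit z : ℕ) := rfl

/-- The substitution `t ↦ 1/t - d`, with the digit `d` of `z` used for both roots, is unimodular up
to sign and so preserves the discriminant. -/
theorem AreConjugate.gaussMap {D : ℤ} {z : Omega} {z' : ℝ} (h : AreConjugate D z z') :
    AreConjugate D (gaussMap z) (z'⁻¹ - (firstDigit z : ℕ)) := by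
  obtain ⟨hne, hirr, A, B, C, hA, h1, h2, hD⟩ := h
  have hz := z.2.2
  have step : ∀ t : ℝ, Irrational t → (A : ℝ) * t ^ 2 + B * t + C = 0 →
      (C : ℝ) * (t⁻¹ - (firstDigit z : ℕ)) ^ 2 +
        ((B + 2 * C * (firstDigit z : ℕ) : ℤ) : ℝ) * (t⁻¹ - (firstDigit z : ℕ)) +
        ((A + B * (firstDigit z : ℕ) + C * (firstDigit z : ℕ) ^ 2 : ℤ) : ℝ) = 0 := by
    intro t ht h
    have h0 := ht.ne_zero
    have : (C : ℝ) * t⁻¹ ^ 2 + B * t⁻¹ + A = 0 := by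
      field_simp
      linear_combination h
    push_cast
    linear_combination this
  refine ⟨fun h => hne ?_, (irrational_inv_iff.2 hirr).sub_natCast _,
    C, B + 2 * C * (firstDigit z : ℕ), A + B * (firstDigit z : ℕ) + C * (firstDigit z : ℕ) ^ 2,
    ?_, ?_, step z' hirr h2, ?_⟩
  · rw [coe_gaussMap] at h
    exact inv_injective (by linarith)
  · rintro rfl
    refine denom_ne_zero hz (c := A) (d := B) (Or.inl hA) ?_
    refine (mul_eq_zero.1 (?_ : (z : ℝ) * (A * z + B) = 0)).resolve_left hz.ne_zero
    push_cast at h1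
    linear_combination h1
  · rw [coe_gaussMap]; exact step z hz h1
  · rw [← hD]; ring

/-- Two numbers with the same infinite sequence of digits are equal. -/
theorem eq_of_forall_gaussMap {P : Omega → ℝ → Prop}
    (hP : ∀ z z', P z z' → 0 < z' ∧ P (gaussMap z) (z'⁻¹ - (firstDigit z : ℕ)))
    {z : Omega} {z' : ℝ} (h : P z z') : (z : ℝ) = z' := by
  have key : ∀ (n : ℕ) z z', P z z' → ∃ (w : List ℕ+) (u v : ℝ), w.length = n ∧
      u ∈ Set.Icc (0 : ℝ) 1 ∧ v ∈ Set.Icc (0 : ℝ) 1 ∧ z = cfEval w u ∧ z' = cfEval w v := by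
    intro n
    induction n with
    | zero =>
      intro z z' h
      -- Applying `hP` twice gives `0 < z'` and `z'⁻¹ > firstDigit z ≥ 1`, which places `z'` in `[0,
      -- 1]`.
      obtain ⟨h0, h1⟩ := hP _ _ h
      have h2 := (hP _ _ h1).1
      have hd : (1 : ℝ) ≤ (firstDigit z : ℕ) := by exact_mod_cast (firstDigit z).2
      refine ⟨[], z, z', rfl, z.2.1, ⟨h0.le, ?_⟩, rfl, rfl⟩
      rw [← one_le_inv₀ h0]
      linarith
    | succ n ih =>
      intro z z' h
      obtain ⟨h0, h1⟩ := hP _ _ h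
      obtain ⟨w, u, v, hw, hu, hv, e1, e2⟩ := ih _ _ h1
      refine ⟨firstDigit z :: w, u, v, by simp [hw], hu, hv, ?_, ?_⟩
      · change _ = 1 / (((firstDigit z : ℕ) : ℝ) + cfEval w u)
        rw [← e1, coe_gaussMap]
        simp
      · change _ = 1 / (((firstDigit z : ℕ) : ℝ) + cfEval w v)
        rw [← e2]
        simp
  have hle : ∀ n : ℕ, |(z : ℝ) - z'| ≤ 2 * (1 / 2) ^ n := by
    intro n
    obtain ⟨w, u, v, hw, hu, hv, e1, e2⟩ := key n z z' h
    rw [e1, e2, ← hw]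
    exact abs_cfEval_sub_le w hu hv
  have h0 : Filter.Tendsto (fun n : ℕ => 2 * (1 / 2 : ℝ) ^ n) Filter.atTop (𝓝 0) := by
    simpa using (tendsto_pow_atTop_nhds_zero_of_lt_one (by norm_num : (0 : ℝ) ≤ 1 / 2)
      (by norm_num)).const_mul 2
  have := ge_of_tendsto' h0 hle
  exact sub_eq_zero.1 (abs_nonpos_iff.1 this)

/-- A conjugate that stayed positive forever would follow the digits of `z` and so equal `z`. -/
theorem AreConjugate.exists_neg {D : ℤ} {z : Omega} {z' : ℝ} (h : AreConjugate D z z') :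
    ∃ m t, t < 0 ∧ AreConjugate D (_root_.gaussMap^[m] z) t := by
  by_contra! hneg
  refine h.1 (eq_of_forall_gaussMap
    (P := fun y t => AreConjugate D y t ∧ ∃ m, y = _root_.gaussMap^[m] z) ?_ ⟨h, 0, rfl⟩)
  rintro y t ⟨hc, m, rfl⟩
  refine ⟨lt_of_le_of_ne ?_ hc.2.1.ne_zero.symm, hc.gaussMap, m + 1, ?_⟩
  · by_contra! ht
    exact hneg m t ht hc
  · rw [Function.iterate_succ_apply']

theorem AreConjugate.iterate_neg {D : ℤ} {z : Omega} {t : ℝ} (ht : t < 0)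
    (h : AreConjugate D z t) (n : ℕ) :
    ∃ t, t < 0 ∧ AreConjugate D (_root_.gaussMap^[n] z) t := by
  induction n generalizing z t with
  | zero => exact ⟨t, ht, h⟩
  | succ n ih =>
    rw [Function.iterate_succ_apply]
    refine ih (t := t⁻¹ - (firstDigit z : ℕ)) ?_ h.gaussMap
    have h1 := inv_lt_zero.2 ht
    have h2 : (0 : ℝ) ≤ (firstDigit z : ℕ) := by positivity
    linarith

/-- Roots of opposite sign give `AC < 0`, so `D = B² + 4|A||C|` bounds all three coefficients, and
each polynomial has finitely many roots. -/
theorem finite_setOf_areConjugate_neg (D : ℤ) :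
    {z : Omega | ∃ t, t < 0 ∧ AreConjugate D z t}.Finite := by
  have hfin : (⋃ p ∈ (Set.Icc (-D) D ×ˢ Set.Icc (-D) D ×ˢ Set.Icc (-D) D) ∩ {p | p.1 ≠ 0},
      {x : ℝ | (p.1 : ℝ) * x ^ 2 + p.2.1 * x + p.2.2 = 0}).Finite := by
    refine Set.Finite.biUnion (((Set.finite_Icc _ _).prod
      ((Set.finite_Icc _ _).prod (Set.finite_Icc _ _))).subset Set.inter_subset_left) ?_
    rintro ⟨A, B, C⟩ ⟨-, hA⟩
    have hA' : (A : ℝ) ≠ 0 := by exact_mod_cast hA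
    let P : Polynomial ℝ := Polynomial.C (A : ℝ) * Polynomial.X ^ 2 +
      Polynomial.C (B : ℝ) * Polynomial.X + Polynomial.C (C : ℝ)
    have hP : P ≠ 0 := by
      intro h0
      have := Polynomial.degree_quadratic (b := (B : ℝ)) (c := (C : ℝ)) hA'
      change P.degree = 2 at this
      simp [h0] at this
    refine (Polynomial.finite_setOfPred_isRoot hP).subset fun x hx => ?_
    simpa [P, Polynomial.IsRoot] using hx
  refine Set.Finite.of_finite_image (f := Subtype.val) (hfin.subset ?_)
    Subtype.val_injective.injOn
  rintro _ ⟨z, ⟨t, ht, hne, hirr, A, B, C, hA, h1, h2, hD⟩, rfl⟩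
  have hz := omega_pos z
  have hsum : (A : ℝ) * (z + t) + B = 0 := by
    refine (mul_eq_zero.1 (?_ : ((z : ℝ) - t) * _ = 0)).resolve_left (sub_ne_zero.2 hne)
    linear_combination h1 - h2
  have hprod : (C : ℝ) = A * (z * t) := by linear_combination h1 - (z : ℝ) * hsum
  have hA2 : (0 : ℝ) < (A : ℝ) ^ 2 := by positivity
  have hAC : A * C < 0 := by
    have : (A : ℝ) * C < 0 := by
      rw [hprod]
      nlinarith [mul_neg_of_pos_of_neg hz ht]
    exact_mod_cast this
  have hC : C ≠ 0 := by rintro rfl; simp at hAC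
  have hA1 := Int.one_le_abs hA
  have hC1 := Int.one_le_abs hC
  have habs : |A| * |C| = -(A * C) := by rw [← abs_mul, abs_of_neg hAC]
  have hB2 : |B| ^ 2 = B ^ 2 := sq_abs B
  have hB0 := abs_nonneg B
  have bA : |A| ≤ D := by nlinarith [sq_nonneg B]
  have bC : |C| ≤ D := by nlinarith [sq_nonneg B]
  have bB : |B| ≤ D := by nlinarith
  refine Set.mem_biUnion (x := (A, B, C)) ⟨⟨abs_le.1 bA, abs_le.1 bB, abs_le.1 bC⟩, hA⟩ h1

/-- Lagrange's theorem: the Gauss map orbit of a quadratic irrational is finite. -/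
theorem IsQuadratic.exists_iterate_eq {x : Omega} (h : IsQuadratic x) :
    ∃ m n, m < n ∧ gaussMap^[m] x = gaussMap^[n] x := by
  obtain ⟨D, x', hx'⟩ := h.exists_areConjugate
  obtain ⟨m, t, ht, hc⟩ := hx'.exists_neg
  have hni : ¬ Function.Injective fun n => gaussMap^[n] (gaussMap^[m] x) := fun hinj =>
    Set.infinite_of_injective_forall_mem hinj (fun n => hc.iterate_neg ht n)
      (finite_setOf_areConjugate_neg D)
  obtain ⟨i, j, hij, hne⟩ := Function.not_injective_iff.1 hni
  simp only [← Function.iterate_add_apply] at hij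
  rcases lt_or_gt_of_ne hne with h1 | h1
  · exact ⟨_, _, by omega, hij⟩
  · exact ⟨_, _, by omega, hij.symm⟩

/-! ### Repeating blocks of eventually periodic sequences. -/

theorem isPeriodicWith_of_forall_add {a : ℕ → ℕ+} {N k : ℕ} (hk : 0 < k)
    (h : ∀ n, N ≤ n → a (n + k) = a n) :
    IsPeriodicWith a (List.ofFn fun i : Fin N => a i) (List.ofFn fun i : Fin k => a (N + i)) := by
  refine ⟨?_, fun i hi => by simp, fun n i hi => ?_⟩
  · rw [Ne, ← List.length_eq_zero_iff]
    simp [hk.ne']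
  · simp only [List.length_ofFn, List.getElem_ofFn]
    induction n with
    | zero => simp
    | succ n ih =>
      rw [show N + (n + 1) * k + i = N + n * k + i + k by ring, h _ (by omega), ih]

theorem IsPeriodicWith.of_append {a : ℕ → ℕ+} {m J : List ℕ+} (h : IsPeriodicWith a (m ++ J) J) :
    IsPeriodicWith a m J := by
  obtain ⟨hJ, h1, h2⟩ := h
  refine ⟨hJ, fun i hi => ?_, fun n i hi => ?_⟩
  · rw [h1 i (by simp; omega), List.getElem_append_left hi]
  · rcases n with _ | n
    · have := h1 (m.length + i) (by simpa using hi)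
      simpa using this
    · rw [← h2 n i hi, List.length_append]
      congr 1
      ring

/-- Minimize the block length first, then the length of the initial block; a copy of `J` at the end
of the latter could be moved into the periodic part. -/
theorem exists_isRepeatingBlock {a : ℕ → ℕ+} {m J : List ℕ+} (h : IsPeriodicWith a m J) :
    ∃ J, IsRepeatingBlock a J := by
  have hex : ∃ k m J, IsPeriodicWith a m J ∧ J.length = k := ⟨_, m, J, h, rfl⟩
  classical
  obtain ⟨m₁, J₁, h₁, hk⟩ := Nat.find_spec hex
  have hmin : ∀ m' J', IsPeriodicWith a m' J' → Nat.find hex ≤ J'.length := fun m' J' h' =>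
    Nat.find_min' hex ⟨m', J', h', rfl⟩
  have hex2 : ∃ l m J, IsPeriodicWith a m J ∧ J.length = Nat.find hex ∧ m.length = l :=
    ⟨_, m₁, J₁, h₁, hk, rfl⟩
  obtain ⟨m₂, J₂, h₂, hk₂, hl₂⟩ := Nat.find_spec hex2
  refine ⟨J₂, m₂, h₂, fun m' J' h' => hk₂ ▸ hmin m' J' h', ?_⟩
  rintro ⟨m₃, rfl⟩
  have h3 := Nat.find_min' hex2 ⟨m₃, J₂, h₂.of_append, hk₂, rfl⟩
  rw [← hl₂, List.length_append] at h3
  exact h₂.1 (List.length_eq_zero_iff.1 (by omega))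

theorem IsQuadratic.exists_isRepeatingBlock {x : Omega} (h : IsQuadratic x) :
    ∃ J, IsRepeatingBlock (cfe x) J := by
  obtain ⟨m, n, hmn, h⟩ := h.exists_iterate_eq
  refine _root_.exists_isRepeatingBlock
    (isPeriodicWith_of_forall_add (N := m) (k := n - m) (by omega) fun l hl => ?_)
  have h1 := cfe_iterate x m (l - m)
  have h2 := cfe_iterate x n (l - m)
  rw [h] at h1
  rw [show l + (n - m) = n + (l - m) by omega, ← h2, h1]
  congr 1
  omega

theorem IsPeriodicWith.iterate_eq {x : Omega} {m J : List ℕ+} (h : IsPeriodicWith (cfe x) m J) :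
    gaussMap^[J.length] (gaussMap^[m.length] x) = gaussMap^[m.length] x := by
  have hJ : 0 < J.length := List.length_pos_iff.2 h.1
  refine cfe_injective (funext fun n => ?_)
  rw [cfe_iterate, cfe_iterate, cfe_iterate]
  have h1 := h.2.2 (n / J.length) (n % J.length) (Nat.mod_lt _ hJ)
  have h2 := h.2.2 (n / J.length + 1) (n % J.length) (Nat.mod_lt _ hJ)
  have e := Nat.div_add_mod' n J.length
  rw [← h2] at h1
  rw [show m.length + n = m.length + n / J.length * J.length + n % J.length by omega, h1]
  congr 1
  rw [add_mul]
  omega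

theorem IsPeriodicWith.cfe_iterate_eq {x : Omega} {m J : List ℕ+}
    (h : IsPeriodicWith (cfe x) m J) (i : ℕ) (hi : i < J.length) :
    cfe (gaussMap^[m.length] x) i = J[i] := by
  rw [cfe_iterate]
  simpa using h.2.2 0 i hi

/-- The point `y` is the purely periodic tail of `x`; it will index the cyclic vector. Its first
`J.length` iterates are distinct by minimality of `J`: a coincidence would give a shorter period. -/
theorem IsRepeatingBlock.exists_point {x : Omega} {J : List ℕ+}
    (h : IsRepeatingBlock (cfe x) J) :
    ∃ y : Omega, (∃ m, y = gaussMap^[m] x) ∧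
      (∀ l, l ≤ J.length → alphaWord (J.drop l) y = gaussMap^[l] y) ∧
      ∀ k l, k < l → l < J.length → gaussMap^[k] y ≠ gaussMap^[l] y := by
  obtain ⟨m, hp, hmin, -⟩ := h
  refine ⟨_, ⟨m.length, rfl⟩, fun l hl => ?_, fun k l hkl hl heq => ?_⟩
  · have h1 := alphaWord_iterate (J.drop l) (gaussMap^[l] (gaussMap^[m.length] x)) fun i hi => by
      rw [cfe_iterate, hp.cfe_iterate_eq _ (by rw [List.length_drop] at hi; omega)]
      simp
    rwa [← Function.iterate_add_apply, List.length_drop, Nat.sub_add_cancel hl,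
      hp.iterate_eq] at h1
  · have := hmin _ _ (isPeriodicWith_of_forall_add (a := cfe x) (N := m.length + k) (k := l - k)
      (by omega) fun n hn => ?_)
    · simp at this
      omega
    · have e : ∀ j, cfe x (m.length + k + j) = cfe x (m.length + l + j) := by
        intro j
        have := congrFun (congrArg cfe heq) j
        simpa only [cfe_iterate, add_assoc] using this
      obtain ⟨j, rfl⟩ := Nat.exists_eq_add_of_le hn
      rw [e]
      congr 1
      omega

/-! ## General facts about representations of `O_∞` -/

theorem cuntz_induction {p : CuntzAlgebra → Prop} (closed : IsClosed {a | p a})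
    (gen : ∀ i, p (cuntzGen i)) (star_gen : ∀ i, p (star (cuntzGen i)))
    (scalar : ∀ r, p (algebraMap ℂ CuntzAlgebra r)) (add : ∀ a b, p a → p b → p (a + b))
    (mul : ∀ a b, p a → p b → p (a * b)) (a : CuntzAlgebra) : p a := by
  -- The predicate `p` is not assumed stable under `star`, so `p x` and `p (star x)` are carried
  -- together.
  have key : ∀ x ∈ StarAlgebra.adjoin ℂ (Set.range cuntzUniversal),
      ∃ hx : x ∈ cuntzSubalgebra, p ⟨x, hx⟩ ∧ p (star ⟨x, hx⟩) := by
    intro x hx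
    induction hx using StarAlgebra.adjoin_induction with
    | mem x h =>
      obtain ⟨i, rfl⟩ := h
      exact ⟨(cuntzGen i).2, gen i, star_gen i⟩
    | algebraMap r =>
      refine ⟨(algebraMap ℂ CuntzAlgebra r).2, scalar r, ?_⟩
      have h := scalar (star r)
      rw [algebraMap_star_comm] at h
      exact h
    | add x y _ _ hx hy =>
      obtain ⟨hx, h1, h2⟩ := hx
      obtain ⟨hy, h3, h4⟩ := hy
      refine ⟨add_mem hx hy, add _ _ h1 h3, ?_⟩
      have h := add _ _ h2 h4
      rw [← star_add] at h
      exact h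
    | mul x y _ _ hx hy =>
      obtain ⟨hx, h1, h2⟩ := hx
      obtain ⟨hy, h3, h4⟩ := hy
      refine ⟨mul_mem hx hy, mul _ _ h1 h3, ?_⟩
      have h := mul _ _ h4 h2
      rw [← star_mul] at h
      exact h
    | star x _ hx =>
      obtain ⟨hx, h1, h2⟩ := hx
      refine ⟨star_mem hx, h2, ?_⟩
      rw [← star_star (⟨x, hx⟩ : CuntzAlgebra)] at h1
      exact h1
  have hsub : {b : CuntzAlgebra | (b : CuntzProduct) ∈
      StarAlgebra.adjoin ℂ (Set.range cuntzUniversal)} ⊆ {b | p b} := fun b hb => (key b hb).2.1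
  refine closed.closure_subset_iff.2 hsub (closure_subtype.2 ?_)
  have himg : ((↑) : CuntzAlgebra → CuntzProduct) '' {b | (b : CuntzProduct) ∈
      StarAlgebra.adjoin ℂ (Set.range cuntzUniversal)} =
      (StarAlgebra.adjoin ℂ (Set.range cuntzUniversal) : Set CuntzProduct) := by
    ext x
    exact ⟨fun ⟨b, hb, h⟩ => h ▸ hb,
      fun hx => ⟨⟨x, StarSubalgebra.le_topologicalClosure _ hx⟩, hx, rfl⟩⟩
  rw [himg]
  exact a.2

section General

variable {H : Type*} [NormedAddCommGroup H] [InnerProductSpace ℂ H] [CompleteSpace H]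
variable {H' : Type*} [NormedAddCommGroup H'] [InnerProductSpace ℂ H'] [CompleteSpace H']

theorem continuous_rep_apply (π : CuntzAlgebra →⋆ₐ[ℂ] (H →L[ℂ] H)) (v : H) :
    Continuous fun a => π a v := by
  have hf : Continuous π := AddMonoidHomClass.continuous_of_bound π 1
    (fun a => by simpa using NonUnitalStarAlgHom.norm_apply_le π a)
  exact hf.clm_apply continuous_const

theorem rep_mul_apply (π : CuntzAlgebra →⋆ₐ[ℂ] (H →L[ℂ] H)) (a b : CuntzAlgebra) (v : H) :
    π (a * b) v = π a (π b v) := by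
  rw [map_mul]; rfl

theorem inner_rep_left (π : CuntzAlgebra →⋆ₐ[ℂ] (H →L[ℂ] H)) (a : CuntzAlgebra) (v w : H) :
    inner ℂ (π a v) w = inner ℂ v (π (star a) w) := by
  rw [map_star, ContinuousLinearMap.star_eq_adjoint, ContinuousLinearMap.adjoint_inner_right]

theorem star_cuntzGen_apply (π : CuntzAlgebra →⋆ₐ[ℂ] (H →L[ℂ] H)) (i : ℕ+) (v : H) :
    π (star (cuntzGen i)) (π (cuntzGen i) v) = v := by
  rw [← rep_mul_apply, isCuntzFamily_cuntzGen.1]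
  simp

theorem star_cuntzGen_apply_of_ne (π : CuntzAlgebra →⋆ₐ[ℂ] (H →L[ℂ] H)) {i j : ℕ+} (h : i ≠ j)
    (v : H) : π (star (cuntzGen i)) (π (cuntzGen j) v) = 0 := by
  rw [← rep_mul_apply, isCuntzFamily_cuntzGen.1, if_neg h]
  simp

theorem star_cuntzWord_mul_self (w : List ℕ+) : star (cuntzWord w) * cuntzWord w = 1 := by
  induction w with
  | nil => simp [cuntzWord]
  | cons i w ih =>
    have h : cuntzWord (i :: w) = cuntzGen i * cuntzWord w := by simp [cuntzWord]
    rw [h, star_mul, mul_assoc, ← mul_assoc _ (cuntzGen i), isCuntzFamily_cuntzGen.1]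
    simpa using ih

/-- `V` need not be unitary, so the relations for the adjoints do not follow from those for the
generators and are required separately. -/
theorem intertwines_of_gen {π : CuntzAlgebra →⋆ₐ[ℂ] (H →L[ℂ] H)}
    {π' : CuntzAlgebra →⋆ₐ[ℂ] (H' →L[ℂ] H')} (V : H →L[ℂ] H')
    (h : ∀ i v, V (π (cuntzGen i) v) = π' (cuntzGen i) (V v))
    (hstar : ∀ i v, V (π (star (cuntzGen i)) v) = π' (star (cuntzGen i)) (V v))
    (a : CuntzAlgebra) (v : H) : V (π a v) = π' a (V v) := by
  revert v
  refine cuntz_induction (p := fun a => ∀ v, V (π a v) = π' a (V v)) ?_ h hstar ?_ ?_ ?_ a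
  · simp only [Set.ofPred_forall]
    exact isClosed_iInter fun v => isClosed_eq (V.continuous.comp (continuous_rep_apply π v))
      (continuous_rep_apply π' (V v))
  · intro r v
    simp [Algebra.algebraMap_eq_smul_one]
  · intro a b ha hb v
    simp [map_add, ha, hb]
  · intro a b ha hb v
    rw [rep_mul_apply, rep_mul_apply, ha, hb]

theorem isInvariantSubspace_of_gen {π : CuntzAlgebra →⋆ₐ[ℂ] (H →L[ℂ] H)} {K : Submodule ℂ H}
    (hcl : IsClosed (K : Set H)) (h : ∀ i, ∀ v ∈ K, π (cuntzGen i) v ∈ K)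
    (hstar : ∀ i, ∀ v ∈ K, π (star (cuntzGen i)) v ∈ K) : IsInvariantSubspace π K := by
  refine cuntz_induction (p := fun a => ∀ v ∈ K, π a v ∈ K) ?_ h hstar ?_ ?_ ?_
  · simp only [Set.ofPred_forall]
    exact isClosed_iInter fun v => isClosed_iInter fun _ =>
      hcl.preimage (continuous_rep_apply π v)
  · intro r v hv
    simpa [Algebra.algebraMap_eq_smul_one] using K.smul_mem r hv
  · intro a b ha hb v hv
    simpa [map_add] using K.add_mem (ha v hv) (hb v hv)
  · intro a b ha hb v hv
    rw [rep_mul_apply]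
    exact ha _ (hb v hv)

/-- The closed span of a set that is invariant, up to zero, under the generators and their
adjoints is an invariant subspace. -/
theorem isInvariantSubspace_closure_span {π : CuntzAlgebra →⋆ₐ[ℂ] (H →L[ℂ] H)} {S : Set H}
    (h : ∀ i, ∀ v ∈ S, π (cuntzGen i) v ∈ S)
    (hstar : ∀ i, ∀ v ∈ S, π (star (cuntzGen i)) v ∈ S ∨ π (star (cuntzGen i)) v = 0) :
    IsInvariantSubspace π (Submodule.span ℂ S).topologicalClosure := by
  have key : ∀ T : H →L[ℂ] H, (∀ v ∈ S, T v ∈ S ∨ T v = 0) →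
      ∀ v ∈ (Submodule.span ℂ S).topologicalClosure,
        T v ∈ (Submodule.span ℂ S).topologicalClosure := by
    intro T hT
    have : (Submodule.span ℂ S).topologicalClosure ≤
        (Submodule.span ℂ S).topologicalClosure.comap T.toLinearMap := by
      refine Submodule.topologicalClosure_minimal _ (Submodule.span_le.2 fun v hv => ?_)
        ((Submodule.isClosed_topologicalClosure _).preimage T.continuous)
      refine Submodule.le_topologicalClosure _ ?_
      rcases hT v hv with h | h
      · exact Submodule.subset_span h
      · change T v ∈ _
        rw [h]
        exact zero_mem _
    exact this
  exact isInvariantSubspace_of_gen (Submodule.isClosed_topologicalClosure _)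
    (fun i => key _ fun v hv => Or.inl (h i v hv)) fun i => key _ (hstar i)

theorem IsInvariantSubspace.orthogonal {π : CuntzAlgebra →⋆ₐ[ℂ] (H →L[ℂ] H)}
    {K : Submodule ℂ H} (hK : IsInvariantSubspace π K) : IsInvariantSubspace π Kᗮ := by
  intro a v hv
  rw [Submodule.mem_orthogonal] at hv ⊢
  intro u hu
  have := hv _ (hK (star a) u hu)
  rwa [inner_rep_left, star_star] at this

theorem IsInvariantSubspace.orthogonalProjectionOnto_apply
    {π : CuntzAlgebra →⋆ₐ[ℂ] (H →L[ℂ] H)} {K : Submodule ℂ H} [CompleteSpace K]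
    (hK : IsInvariantSubspace π K) (a : CuntzAlgebra) (v : H) :
    K.orthogonalProjectionOnto (π a v) = subrep π K hK a (K.orthogonalProjectionOnto v) := by
  refine Subtype.ext ?_
  rw [subrep_apply]
  refine Submodule.eq_starProjection_of_mem_orthogonal (hK a _ (Subtype.prop _)) ?_
  rw [← map_sub]
  exact hK.orthogonal a _ (Submodule.sub_starProjection_mem_orthogonal v)

/-- The closure of the orbit of `v` is invariant and contains `v = π(1) v`. -/
theorem IsIrreducibleRep.isCyclicVector {π : CuntzAlgebra →⋆ₐ[ℂ] (H →L[ℂ] H)}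
    (hπ : IsIrreducibleRep π) {v : H} (hv : v ≠ 0) : IsCyclicVector π v := by
  let L : CuntzAlgebra →ₗ[ℂ] H :=
    { toFun := fun a => π a v
      map_add' := fun a b => by simp
      map_smul' := fun c a => by simp }
  have hinv : IsInvariantSubspace π (LinearMap.range L).topologicalClosure := by
    intro a
    have : (LinearMap.range L).topologicalClosure ≤
        (LinearMap.range L).topologicalClosure.comap (π a).toLinearMap := by
      refine Submodule.topologicalClosure_minimal _ ?_
        ((Submodule.isClosed_topologicalClosure _).preimage (π a).continuous)
      rintro _ ⟨b, rfl⟩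
      refine Submodule.le_topologicalClosure _ ⟨a * b, ?_⟩
      exact rep_mul_apply π a b v
    exact this
  rcases hπ.2 _ (Submodule.isClosed_topologicalClosure _) hinv with h | h
  · have hmem : v ∈ (LinearMap.range L).topologicalClosure :=
      Submodule.le_topologicalClosure _ ⟨1, by simp [L]⟩
    rw [h, Submodule.mem_bot] at hmem
    exact absurd hmem hv
  · exact (Submodule.dense_iff_topologicalClosure_eq_top.2 h)

theorem IsIrreducibleRep.eq_top {π : CuntzAlgebra →⋆ₐ[ℂ] (H →L[ℂ] H)}
    (hπ : IsIrreducibleRep π) {K : Submodule ℂ H} (hcl : IsClosed (K : Set H))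
    (hK : IsInvariantSubspace π K) {v : H} (hv : v ∈ K) (hv0 : v ≠ 0) : K = ⊤ :=
  (hπ.2 K hcl hK).resolve_left fun h => hv0 (by rwa [h, Submodule.mem_bot] at hv)

end General

/-! ## The representation `π_α` on basis vectors -/

theorem stdBasis_ne_zero (x : Omega) : stdBasis x ≠ 0 := orthonormal_stdBasis.ne_zero x

theorem star_cuntzGen_stdBasis_of_eq {i : ℕ+} {x : Omega} (h : cfe x 0 = i) :
    piAlpha (star (cuntzGen i)) (stdBasis x) = stdBasis (gaussMap x) := by
  conv_lhs => rw [← alpha_cfe_gaussMap x, h, ← piAlpha_cuntzGen_stdBasis]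
  exact star_cuntzGen_apply _ _ _

theorem star_cuntzGen_stdBasis_of_ne {i : ℕ+} {x : Omega} (h : i ≠ cfe x 0) :
    piAlpha (star (cuntzGen i)) (stdBasis x) = 0 := by
  conv_lhs => rw [← alpha_cfe_gaussMap x, ← piAlpha_cuntzGen_stdBasis]
  exact star_cuntzGen_apply_of_ne _ h _

theorem piAlpha_cuntzWord_stdBasis (w : List ℕ+) (x : Omega) :
    piAlpha (cuntzWord w) (stdBasis x) = stdBasis (alphaWord w x) := by
  induction w with
  | nil => simp [cuntzWord, alphaWord]
  | cons i w ih =>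
    have h : cuntzWord (i :: w) = cuntzGen i * cuntzWord w := by simp [cuntzWord]
    rw [h, rep_mul_apply, ih, piAlpha_cuntzGen_stdBasis]
    rfl

theorem star_cuntzWord_stdBasis (x : Omega) (n : ℕ) :
    piAlpha (star (cuntzWord (List.ofFn fun l : Fin n => cfe x l))) (stdBasis x) =
      stdBasis (gaussMap^[n] x) := by
  have h := alphaWord_iterate (List.ofFn fun l : Fin n => cfe x l) x fun i hi => by simp
  rw [List.length_ofFn] at h
  conv_lhs => rw [← h, ← piAlpha_cuntzWord_stdBasis, h]
  rw [← rep_mul_apply, star_cuntzWord_mul_self]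
  simp

/-- `w` consists of the digits of `x` up to the first that differs from that of `y`; then `stdBasis
y` is orthogonal to the range of `s_w`. -/
theorem exists_word_separating {x y : Omega} (h : x ≠ y) :
    ∃ w z, alphaWord w z = x ∧ piAlpha (star (cuntzWord w)) (stdBasis y) = 0 := by
  have hd : ∃ n, cfe x n ≠ cfe y n := by
    by_contra! h'
    exact h (cfe_injective (funext h'))
  obtain ⟨n, hn⟩ := hd
  clear h
  induction n generalizing x y with
  | zero =>
    refine ⟨[cfe x 0], gaussMap x, alpha_cfe_gaussMap x, ?_⟩
    rw [show cuntzWord [cfe x 0] = cuntzGen (cfe x 0) by simp [cuntzWord]]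
    exact star_cuntzGen_stdBasis_of_ne hn
  | succ n ih =>
    obtain ⟨w, z, h1, h2⟩ := ih (x := gaussMap x) (y := gaussMap y) (by
      rwa [cfe_gaussMap, cfe_gaussMap])
    refine ⟨cfe x 0 :: w, z, ?_, ?_⟩
    · change alpha _ (alphaWord w z) = x
      rw [h1, alpha_cfe_gaussMap]
    · rw [show cuntzWord (cfe x 0 :: w) = cuntzGen (cfe x 0) * cuntzWord w by simp [cuntzWord],
        star_mul, rep_mul_apply]
      by_cases h : cfe y 0 = cfe x 0
      · rw [star_cuntzGen_stdBasis_of_eq h, h2]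
      · rw [star_cuntzGen_stdBasis_of_ne (Ne.symm h), map_zero]

/-- The commutant of `π_α` consists of diagonal operators. -/
theorem exists_eq_smul_of_commute {T : L2Omega →L[ℂ] L2Omega}
    (hT : ∀ a v, T (piAlpha a v) = piAlpha a (T v)) (x : Omega) :
    ∃ c : ℂ, T (stdBasis x) = c • stdBasis x := by
  classical
  refine ⟨T (stdBasis x) x, lp.ext (funext fun y => ?_)⟩
  rw [lp.coeFn_smul, Pi.smul_apply, ← inner_stdBasis y (stdBasis x),
    orthonormal_iff_ite.1 orthonormal_stdBasis]
  split_ifs with h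
  · subst h; simp
  -- With `e_x = s_w e_z` and `s_w* e_y = 0`, the matrix entry is `⟨e_y, T s_w e_z⟩ = ⟨s_w* e_y, T
  -- e_z⟩ = 0`.
  · obtain ⟨w, z, h1, h2⟩ := exists_word_separating (Ne.symm h)
    rw [← inner_stdBasis, ← h1, ← piAlpha_cuntzWord_stdBasis, hT, ← star_star (cuntzWord w),
      ← inner_rep_left, h2]
    simp

/-- The projection onto `K` commutes with `piAlpha`, hence is diagonal; `c` is its eigenvalue at
`stdBasis x`. -/
theorem stdBasis_mem_or_mem_orthogonal {K : Submodule ℂ L2Omega} [CompleteSpace K]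
    (hK : IsInvariantSubspace piAlpha K) (x : Omega) : stdBasis x ∈ K ∨ stdBasis x ∈ Kᗮ := by
  obtain ⟨c, hc⟩ := exists_eq_smul_of_commute (T := K.starProjection) (fun a v => by
    exact congrArg Subtype.val (hK.orthogonalProjectionOnto_apply a v)) x
  have hmem : K.starProjection (stdBasis x) ∈ K := by
    rw [Submodule.starProjection_apply]; exact Subtype.prop _
  rcases eq_or_ne c 0 with rfl | h0
  · right
    have := K.sub_starProjection_mem_orthogonal (stdBasis x)
    rwa [hc, zero_smul, sub_zero] at this
  · left
    rw [hc] at hmem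
    exact (K.smul_mem_iff h0).1 hmem

/-- The component of `v ∈ K` orthogonal to `L` has no coordinate at `x` with `stdBasis x ∈ L`; at
the other `x`, the basis vector is orthogonal to both `K` and `L`. -/
theorem le_of_stdBasis {K L : Submodule ℂ L2Omega} [CompleteSpace L]
    (hK : ∀ x, stdBasis x ∈ K ∨ stdBasis x ∈ Kᗮ) (hL : ∀ x, stdBasis x ∈ L ∨ stdBasis x ∈ Lᗮ)
    (h : ∀ x, stdBasis x ∈ K → stdBasis x ∈ L) : K ≤ L := by
  intro v hv
  have hr := L.sub_starProjection_mem_orthogonal v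
  have hp : L.starProjection v ∈ L := by
    rw [Submodule.starProjection_apply]; exact Subtype.prop _
  have h0 : v - L.starProjection v = 0 := by
    refine lp.ext (funext fun x => ?_)
    rw [← inner_stdBasis]
    by_cases hx : stdBasis x ∈ L
    · exact (Submodule.mem_orthogonal _ _).1 hr _ hx
    · have h1 := (Submodule.mem_orthogonal' _ _).1 ((hL x).resolve_left hx) _ hp
      have h2 := (Submodule.mem_orthogonal' _ _).1 ((hK x).resolve_left fun h' => hx (h x h')) _ hv
      rw [inner_sub_right, h1, h2]
      simp
  rw [sub_eq_zero] at h0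
  rw [h0]
  exact hp

theorem eq_top_of_stdBasis_mem {K : Submodule ℂ L2Omega} [CompleteSpace K]
    (h : ∀ x, stdBasis x ∈ K) : K = ⊤ :=
  top_unique (le_of_stdBasis (fun _ => Or.inl trivial) (fun x => Or.inl (h x)) fun x _ => h x)

theorem stdBasis_alpha_mem_iff {K : Submodule ℂ L2Omega} (hK : IsInvariantSubspace piAlpha K)
    (i : ℕ+) (x : Omega) : (stdBasis (alpha i x) ∈ K) = (stdBasis x ∈ K) := by
  refine propext ⟨fun h => ?_, fun h => ?_⟩
  · have := hK (star (cuntzGen i)) _ h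
    rwa [star_cuntzGen_stdBasis_of_eq (cfe_alpha_zero i x), gaussMap_alpha] at this
  · rw [← piAlpha_cuntzGen_stdBasis]
    exact hK _ _ h

/-- Serret's theorem applied to the predicate `stdBasis x ∈ K`. -/
theorem stdBasis_mem_of_mk_eq {K : Submodule ℂ L2Omega} (hK : IsInvariantSubspace piAlpha K)
    {x y : Omega} (h : Quotient.mk omegaSetoid x = Quotient.mk omegaSetoid y)
    (hx : stdBasis x ∈ K) : stdBasis y ∈ K := by
  have := apply_eq_of_modularEquiv (c := fun x => stdBasis x ∈ K)
    (stdBasis_alpha_mem_iff hK) (Quotient.exact h)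
  exact this.mp hx

/-! ## The subrepresentations `η_[x]` -/

theorem stdBasis_mem_classSubspace {x : Omega} {q : Quotient omegaSetoid}
    (h : Quotient.mk omegaSetoid x = q) : stdBasis x ∈ classSubspace q :=
  Submodule.le_topologicalClosure _ (Submodule.subset_span ⟨x, h, rfl⟩)

theorem classSubspace_le {q : Quotient omegaSetoid} {K : Submodule ℂ L2Omega}
    (hK : IsClosed (K : Set L2Omega))
    (h : ∀ x, Quotient.mk omegaSetoid x = q → stdBasis x ∈ K) : classSubspace q ≤ K := by
  refine Submodule.topologicalClosure_minimal _ (Submodule.span_le.2 ?_) hK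
  rintro _ ⟨x, hx, rfl⟩
  exact h x hx

theorem isInvariantSubspace_classSubspace (q : Quotient omegaSetoid) :
    IsInvariantSubspace piAlpha (classSubspace q) := by
  refine isInvariantSubspace_closure_span ?_ ?_
  · rintro i _ ⟨x, hx, rfl⟩
    rw [piAlpha_cuntzGen_stdBasis]
    exact ⟨_, (mk_alpha i x).trans hx, rfl⟩
  · rintro i _ ⟨x, hx, rfl⟩
    by_cases h : cfe x 0 = i
    · rw [star_cuntzGen_stdBasis_of_eq h]
      exact Or.inl ⟨_, (apply_iterate_gaussMap mk_alpha 1 x).trans hx, rfl⟩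
    · exact Or.inr (star_cuntzGen_stdBasis_of_ne (Ne.symm h))

theorem classSubspace_isOrtho {p q : Quotient omegaSetoid} (h : p ≠ q) :
    classSubspace p ⟂ classSubspace q := by
  rw [Submodule.isOrtho_iff_le]
  refine classSubspace_le (Submodule.isClosed_orthogonal _) fun x hx => ?_
  have hle : classSubspace q ≤ (Submodule.span ℂ {stdBasis x})ᗮ := by
    refine classSubspace_le (Submodule.isClosed_orthogonal _) fun y hy => ?_
    rw [Submodule.mem_orthogonal_singleton_iff_inner_right]
    refine orthonormal_stdBasis.2 ?_
    rintro rfl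
    exact h (hx.symm.trans hy)
  rw [Submodule.mem_orthogonal']
  intro u hu
  exact Submodule.mem_orthogonal_singleton_iff_inner_right.1 (hle hu)

theorem isHilbertSum_classSubspace : IsHilbertSum ℂ (fun q => classSubspace q)
    (fun q => (classSubspace q).subtypeₗᵢ) := by
  refine IsHilbertSum.mkInternal _ (OrthogonalFamily.of_pairwise fun p q h =>
    classSubspace_isOrtho h) ?_
  refine (eq_top_of_stdBasis_mem fun x => ?_).ge
  exact Submodule.le_topologicalClosure _
    (Submodule.mem_iSup_of_mem _ (stdBasis_mem_classSubspace rfl))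

/-- An invariant subspace of `classSubspace q`, viewed in `l₂(Ω)`, contains all basis vectors of the
class or is orthogonal to all of them. -/
theorem isIrreducibleRep_eta (hinv : ∀ q, IsInvariantSubspace piAlpha (classSubspace q))
    (q : Quotient omegaSetoid) : IsIrreducibleRep (eta hinv q) := by
  obtain ⟨x, hx⟩ := Quotient.exists_rep q
  refine ⟨⟨⟨stdBasis x, stdBasis_mem_classSubspace hx⟩, 0, fun h =>
    stdBasis_ne_zero x (congrArg Subtype.val h)⟩, fun K hK hinvK => ?_⟩
  set L := K.map (classSubspace q).subtype with hL
  have hLK : ∀ v : classSubspace q, (v : L2Omega) ∈ L ↔ v ∈ K := fun v => by simp [hL]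
  have : CompleteSpace L := by
    refine IsComplete.completeSpace_coe ?_
    exact (LinearIsometry.isComplete_image_iff (classSubspace q).subtypeₗᵢ (s := (K : Set _))).2
      hK.isComplete
  have hLinv : IsInvariantSubspace piAlpha L := by
    rintro a _ ⟨v, hv, rfl⟩
    exact ⟨eta hinv q a v, hinvK a v hv, rfl⟩
  by_cases h : stdBasis x ∈ L
  · right
    have hle : classSubspace q ≤ L := classSubspace_le
      (IsComplete.isClosed (completeSpace_coe_iff_isComplete.1 this)) fun y hy =>
        stdBasis_mem_of_mk_eq hLinv (hx.trans hy.symm) h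
    exact top_unique fun v _ => (hLK v).1 (hle v.2)
  · left
    have hle : classSubspace q ≤ Lᗮ := by
      refine classSubspace_le (Submodule.isClosed_orthogonal _) fun y hy => ?_
      refine (stdBasis_mem_or_mem_orthogonal hLinv y).resolve_left fun hy' => h ?_
      exact stdBasis_mem_of_mk_eq hLinv (hy.trans hx.symm) hy'
    refine (Submodule.eq_bot_iff _).2 fun v hv => ?_
    have := (Submodule.mem_orthogonal _ _).1 (hle v.2) _ ((hLK v).2 hv)
    exact Subtype.ext (inner_self_eq_zero.1 this)

/-! ### Unitary equivalence of subrepresentations of `piAlpha`. -/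

theorem stdBasis_mem_of_unitarilyEquivalent {K L : Submodule ℂ L2Omega} [CompleteSpace K]
    [CompleteSpace L] (hK : IsInvariantSubspace piAlpha K) (hL : IsInvariantSubspace piAlpha L)
    (h : UnitarilyEquivalent (subrep piAlpha K hK) (subrep piAlpha L hL)) {x : Omega}
    (hx : stdBasis x ∈ K) : stdBasis x ∈ L := by
  obtain ⟨U, hU⟩ := h
  -- The intertwiner extended by zero on `Kᗮ` lies in the commutant, so `T e_x = c e_x`; injectivity
  -- of `U` gives `c ≠ 0`, and `T` takes values in `L`.
  let T : L2Omega →L[ℂ] L2Omega :=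
    L.subtypeL ∘L (U.toContinuousLinearEquiv : K →L[ℂ] L) ∘L K.orthogonalProjectionOnto
  have hT : ∀ v, T v = (U (K.orthogonalProjectionOnto v) : L2Omega) := fun v => rfl
  obtain ⟨c, hc⟩ := exists_eq_smul_of_commute (T := T) (fun a v => by
    rw [hT, hT, hK.orthogonalProjectionOnto_apply, ← subrep_apply piAlpha L hL, ← hU,
      LinearIsometryEquiv.symm_apply_apply]) x
  have hx' : K.orthogonalProjectionOnto (stdBasis x) = ⟨stdBasis x, hx⟩ :=
    K.orthogonalProjectionOnto_mem_subspace_eq_self ⟨stdBasis x, hx⟩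
  rw [hT, hx'] at hc
  have hmem : c • stdBasis x ∈ L := hc ▸ Subtype.prop _
  refine (L.smul_mem_iff ?_).1 hmem
  rintro rfl
  rw [zero_smul, ZeroMemClass.coe_eq_zero, map_eq_zero_iff U U.injective] at hc
  exact stdBasis_ne_zero x (congrArg Subtype.val hc)

theorem UnitarilyEquivalent.symm {H : Type*} [NormedAddCommGroup H] [InnerProductSpace ℂ H]
    [CompleteSpace H] {H' : Type*} [NormedAddCommGroup H'] [InnerProductSpace ℂ H']
    [CompleteSpace H'] {π : CuntzAlgebra →⋆ₐ[ℂ] (H →L[ℂ] H)}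
    {π' : CuntzAlgebra →⋆ₐ[ℂ] (H' →L[ℂ] H')} (h : UnitarilyEquivalent π π') :
    UnitarilyEquivalent π' π := by
  obtain ⟨U, hU⟩ := h
  refine ⟨U.symm, fun a v => ?_⟩
  have := hU a (U v)
  rw [U.symm_apply_apply] at this
  rw [U.symm_symm, ← this, U.symm_apply_apply]

theorem isMultiplicityFree_piAlpha : IsMultiplicityFree piAlpha := by
  intro K L _ _ hK hL h
  exact le_antisymm
    (le_of_stdBasis (stdBasis_mem_or_mem_orthogonal hK) (stdBasis_mem_or_mem_orthogonal hL)
      fun x hx => stdBasis_mem_of_unitarilyEquivalent hK hL h hx)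
    (le_of_stdBasis (stdBasis_mem_or_mem_orthogonal hL) (stdBasis_mem_or_mem_orthogonal hK)
      fun x hx => stdBasis_mem_of_unitarilyEquivalent hL hK h.symm hx)

theorem unitarilyEquivalent_eta_iff (hinv : ∀ q, IsInvariantSubspace piAlpha (classSubspace q))
    (x y : Omega) : UnitarilyEquivalent (eta hinv (Quotient.mk omegaSetoid x))
      (eta hinv (Quotient.mk omegaSetoid y)) ↔ ModularEquiv (x : ℝ) (y : ℝ) := by
  refine ⟨fun h => Quotient.exact (s := omegaSetoid) ?_, fun h => ?_⟩
  · by_contra hne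
    have hx := stdBasis_mem_of_unitarilyEquivalent _ _ h (stdBasis_mem_classSubspace rfl)
    have := Submodule.isOrtho_iff_inner_eq.1 (classSubspace_isOrtho hne) _
      (stdBasis_mem_classSubspace rfl) _ hx
    exact stdBasis_ne_zero x (inner_self_eq_zero.1 this)
  · have : Quotient.mk omegaSetoid x = Quotient.mk omegaSetoid y := Quotient.sound h
    rw [this]
    exact ⟨LinearIsometryEquiv.refl ℂ _, fun a v => rfl⟩

/-! ### Membership in the classes `P(J)`. -/

theorem isCyclicVector_eta (hinv : ∀ q, IsInvariantSubspace piAlpha (classSubspace q))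
    {q : Quotient omegaSetoid} {x : Omega} (hx : Quotient.mk omegaSetoid x = q) :
    IsCyclicVector (eta hinv q) ⟨stdBasis x, stdBasis_mem_classSubspace hx⟩ :=
  (isIrreducibleRep_eta hinv q).isCyclicVector fun h =>
    stdBasis_ne_zero x (congrArg Subtype.val h)

theorem isChainRep_eta (hinv : ∀ q, IsInvariantSubspace piAlpha (classSubspace q)) {x : Omega}
    (hx : ¬ IsQuadratic x) : IsChainRep (cfe x) (eta hinv (Quotient.mk omegaSetoid x)) := by
  refine ⟨⟨stdBasis x, stdBasis_mem_classSubspace rfl⟩, orthonormal_stdBasis.1 x,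
    isCyclicVector_eta hinv rfl, ?_⟩
  refine ((classSubspace (Quotient.mk omegaSetoid x)).subtypeₗᵢ.orthonormal_comp_iff).1 ?_
  -- The exponent is `n + 1` because the family starts with the word of length one.
  convert orthonormal_stdBasis.comp (fun n => gaussMap^[n + 1] x) ?_ using 1
  · funext n
    rw [Function.comp_apply, ← map_star]
    exact star_cuntzWord_stdBasis x (n + 1)
  · intro m n h
    have := iterate_gaussMap_injective hx h
    omega

/-- The cyclic vector belongs to the purely periodic tail `y` rather than to `x`, which `s_J` need
not fix. -/
theorem isCycleRep_eta (hinv : ∀ q, IsInvariantSubspace piAlpha (classSubspace q)) {x : Omega}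
    {J : List ℕ+} (h : IsRepeatingBlock (cfe x) J) :
    IsCycleRep J (eta hinv (Quotient.mk omegaSetoid x)) := by
  obtain ⟨y, ⟨m, hm⟩, hw, hne⟩ := h.exists_point
  obtain ⟨m', ⟨hJ, -⟩, -⟩ := h
  have hyx : Quotient.mk omegaSetoid y = Quotient.mk omegaSetoid x := by
    rw [hm]; exact apply_iterate_gaussMap mk_alpha m x
  refine ⟨hJ, ⟨stdBasis y, stdBasis_mem_classSubspace hyx⟩, orthonormal_stdBasis.1 y,
    isCyclicVector_eta hinv hyx, Subtype.ext ?_, ?_⟩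
  · refine (piAlpha_cuntzWord_stdBasis J y).trans ?_
    have := hw 0 (by simp)
    simp only [List.drop_zero, Function.iterate_zero, id_eq] at this
    rw [this]
  · refine ((classSubspace (Quotient.mk omegaSetoid x)).subtypeₗᵢ.orthonormal_comp_iff).1 ?_
    convert orthonormal_stdBasis.comp (fun l : Fin J.length => gaussMap^[(l : ℕ)] y) ?_ using 1
    · funext l
      rw [Function.comp_apply, Function.comp_apply, ← hw l l.2.le]
      exact piAlpha_cuntzWord_stdBasis _ y
    · intro k l hkl
      rcases lt_trichotomy (k : ℕ) l with h1 | h1 | h1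
      · exact absurd hkl (hne _ _ h1 l.2)
      · exact Fin.ext h1
      · exact absurd hkl.symm (hne _ _ h1 k.2)

/-! ## Branching systems -/

/-- Injections of a set with disjoint ranges that cover the set. The letter of a point is the index
of the range that contains it, and the shift inverts the injections. -/
structure BranchingSystem (ι : Type*) where
  map : ℕ+ → ι → ι
  letter : ι → ℕ+
  shift : ι → ι
  map_letter_shift : ∀ x, map (letter x) (shift x) = x
  letter_map : ∀ i x, letter (map i x) = i
  shift_map : ∀ i x, shift (map i x) = x

/-- The branching system of the maps `α_i`. -/
def omegaBranching : BranchingSystem Omega where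
  map := alpha
  letter := firstDigit
  shift := gaussMap
  map_letter_shift := alpha_firstDigit
  letter_map := firstDigit_alpha
  shift_map := gaussMap_alpha

namespace BranchingSystem

variable {ι : Type*} (B : BranchingSystem ι)

/-- The sequence of letters along the orbit of the shift. -/
def letters (x : ι) (n : ℕ) : ℕ+ := B.letter (B.shift^[n] x)

theorem letters_iterate (x : ι) (m n : ℕ) : B.letters (B.shift^[m] x) n = B.letters x (m + n) := by
  rw [letters, ← Function.iterate_add_apply, add_comm, letters]

theorem letters_shift (x : ι) (n : ℕ) : B.letters (B.shift x) n = B.letters x (n + 1) := rfl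

theorem shift_iterate_succ_map (i : ℕ+) (x : ι) (n : ℕ) :
    B.shift^[n + 1] (B.map i x) = B.shift^[n] x := by
  rw [Function.iterate_succ_apply, B.shift_map]

/-- The point of `Ω` whose continued fraction digits are the letters of `x`. -/
def code (x : ι) : Omega := ofDigits (B.letters x)

theorem code_map (i : ℕ+) (x : ι) : B.code (B.map i x) = alpha i (B.code x) := by
  rw [code, ← alpha_ofDigits]
  simp only [← letters_shift, B.shift_map]
  rw [letters, Function.iterate_zero, id_eq, B.letter_map]
  rfl

theorem letters_eq_of_code_eq {x y : ι} (h : B.code x = B.code y) : B.letters x = B.letters y := by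
  rw [← cfe_ofDigits (B.letters x), ← cfe_ofDigits (B.letters y)]
  exact congrArg cfe h

/-- Replace the `n`-th shift of `x` by `y`, keeping the first `n` letters of `x`. -/
def graft : ℕ → ι → ι → ι
  | 0, _, y => y
  | n + 1, x, y => B.map (B.letter x) (graft n (B.shift x) y)

theorem graft_succ (n : ℕ) (x y : ι) :
    B.graft (n + 1) x y = B.graft n x (B.map (B.letters x n) y) := by
  induction n generalizing x with
  | zero => rfl
  | succ n ih => rw [graft, ih, graft, letters_shift]

theorem graft_self (n : ℕ) (x : ι) : B.graft n x (B.shift^[n] x) = x := by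
  induction n generalizing x with
  | zero => rfl
  | succ n ih => rw [graft, Function.iterate_succ_apply, ih, B.map_letter_shift]

theorem shift_iterate_graft (n : ℕ) (x y : ι) : B.shift^[n] (B.graft n x y) = y := by
  induction n generalizing x with
  | zero => rfl
  | succ n ih => rw [graft, B.shift_iterate_succ_map, ih]

theorem graft_congr {x x' : ι} (h : B.letters x = B.letters x') (n : ℕ) (y : ι) :
    B.graft n x y = B.graft n x' y := by
  induction n generalizing y with
  | zero => rfl
  | succ n ih => rw [graft_succ, graft_succ, h, ih]

theorem eq_of_letters_eq {x y : ι} (h : B.letters x = B.letters y) {n : ℕ}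
    (hn : B.shift^[n] x = B.shift^[n] y) : x = y := by
  rw [← B.graft_self n x, hn, B.graft_congr h, B.graft_self]

section Translation

variable {k : ℕ} (hper : ∀ x, ∃ N, ∀ n, N ≤ n → B.letters x (n + k) = B.letters x n)

/-- When all sequences of letters have eventual period `k`, the map that skips one period. -/
def skip (x : ι) : ι := B.graft (hper x).choose x (B.shift^[(hper x).choose + k] x)

/-- This removes the choice in `skip`: beyond the threshold, letters `n` and `n + k` agree, so
prefixing letter `n` to the shift by `n + 1 + k` restores the shift by `n + k`. -/
theorem exists_skip_eq (x : ι) :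
    ∃ N, ∀ n, N ≤ n → B.skip hper x = B.graft n x (B.shift^[n + k] x) := by
  refine ⟨(hper x).choose, fun n hn => ?_⟩
  induction n, hn using Nat.le_induction with
  | base => rfl
  | succ n hn ih =>
    rw [ih, graft_succ, ← (hper x).choose_spec n hn, Nat.add_right_comm,
      Function.iterate_succ_apply', letters, B.map_letter_shift]

theorem skip_map (i : ℕ+) (x : ι) : B.skip hper (B.map i x) = B.map i (B.skip hper x) := by
  obtain ⟨M, hM⟩ := B.exists_skip_eq hper (B.map i x)
  obtain ⟨N, hN⟩ := B.exists_skip_eq hper x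
  rw [hM (M + N + 1) (by omega), hN (M + N) (by omega), graft, B.letter_map, B.shift_map,
    Nat.add_right_comm, B.shift_iterate_succ_map]

theorem skip_eq_map (x : ι) :
    B.skip hper x = B.map (B.letter x) (B.skip hper (B.shift x)) := by
  rw [← skip_map, B.map_letter_shift]

theorem letters_skip (x : ι) : B.letters (B.skip hper x) = B.letters x := by
  funext n
  induction n generalizing x with
  | zero => rw [skip_eq_map]; exact B.letter_map _ _
  | succ n ih => rw [← letters_shift, skip_eq_map, B.shift_map, ih, letters_shift]

/-- `skip` preserves letters, and equal images force a common late shift; a point is recovered from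
its letters and any one of its shifts. -/
theorem skip_injective : Function.Injective (B.skip hper) := by
  intro x y h
  have hl : B.letters x = B.letters y := by
    rw [← B.letters_skip hper x, h, B.letters_skip]
  obtain ⟨M, hM⟩ := B.exists_skip_eq hper x
  obtain ⟨N, hN⟩ := B.exists_skip_eq hper y
  rw [hM (M + N) (by omega), hN (M + N) (by omega)] at h
  have := congrArg B.shift^[M + N] h
  rw [shift_iterate_graft, shift_iterate_graft] at this
  exact B.eq_of_letters_eq hl this

theorem skip_eq_of_letters_eq {x y : ι} (h : B.letters x = B.letters y) {m : ℕ}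
    (hm : B.shift^[m] x = B.shift^[m + k] y) : B.skip hper y = x := by
  obtain ⟨N, hN⟩ := B.exists_skip_eq hper y
  rw [hN (N + m) (by omega), add_assoc, Function.iterate_add_apply, ← hm,
    ← Function.iterate_add_apply, ← B.graft_congr h, graft_self]

end Translation

/-- In a branching system with one tail class, two points with the same letters force a common
eventual period. -/
theorem exists_eventual_period {x y : ι} (h : B.letters x = B.letters y) {m k : ℕ}
    (hm : B.shift^[m] x = B.shift^[m + k] y)
    (htail : ∀ z, ∃ p q, B.shift^[p] z = B.shift^[q] x) (z : ι) :
    ∃ N, ∀ n, N ≤ n → B.letters z (n + k) = B.letters z n := by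
  have hx : ∀ j, B.letters x (m + j) = B.letters x (m + k + j) := by
    intro j
    rw [← letters_iterate, hm, letters_iterate, h]
  obtain ⟨p, q, hpq⟩ := htail z
  have hz : ∀ j, B.letters z (p + j) = B.letters x (q + j) := by
    intro j
    rw [← letters_iterate, hpq, letters_iterate]
  refine ⟨p + m, fun n hn => ?_⟩
  have e1 := hz (n - p + k)
  have e2 := hz (n - p)
  have e3 := hx (q + (n - p) - m)
  rw [show p + (n - p + k) = n + k by omega] at e1
  rw [show p + (n - p) = n by omega] at e2
  rw [e1, e2, show q + (n - p) = m + (q + (n - p) - m) by omega, e3]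
  congr 1
  omega

end BranchingSystem

/-! ## Permutative representations -/

section Permutative

variable {H : Type*} [NormedAddCommGroup H] [InnerProductSpace ℂ H] [CompleteSpace H]
variable {H' : Type*} [NormedAddCommGroup H'] [InnerProductSpace ℂ H'] [CompleteSpace H']
variable {π : CuntzAlgebra →⋆ₐ[ℂ] (H →L[ℂ] H)} {π' : CuntzAlgebra →⋆ₐ[ℂ] (H' →L[ℂ] H')}

/-- The generators act on the family `b` by the maps of a branching system. -/
def RealizesBranching {ι : Type*} (π : CuntzAlgebra →⋆ₐ[ℂ] (H →L[ℂ] H)) (B : BranchingSystem ι)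
    (b : ι → H) : Prop :=
  ∀ i x, π (cuntzGen i) (b x) = b (B.map i x)

theorem RealizesBranching.star_apply_of_eq {ι : Type*} {B : BranchingSystem ι} {b : ι → H}
    (h : RealizesBranching π B b) {i : ℕ+} {x : ι} (hi : B.letter x = i) :
    π (star (cuntzGen i)) (b x) = b (B.shift x) := by
  conv_lhs => rw [← B.map_letter_shift x, hi, ← h]
  exact star_cuntzGen_apply _ _ _

theorem RealizesBranching.star_apply_of_ne {ι : Type*} {B : BranchingSystem ι} {b : ι → H}
    (h : RealizesBranching π B b) {i : ℕ+} {x : ι} (hi : i ≠ B.letter x) :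
    π (star (cuntzGen i)) (b x) = 0 := by
  conv_lhs => rw [← B.map_letter_shift x, ← h]
  exact star_cuntzGen_apply_of_ne _ hi _

theorem HilbertBasis.exists_linearIsometry {ι H H' : Type*} [NormedAddCommGroup H]
    [InnerProductSpace ℂ H] [NormedAddCommGroup H'] [InnerProductSpace ℂ H'] [CompleteSpace H']
    (b : HilbertBasis ι ℂ H) {c : ι → H'} (hc : Orthonormal ℂ c) : ∃ V : H →ₗᵢ[ℂ] H', ∀ x, V (b x) = c x := by
  classical
  refine ⟨hc.orthogonalFamily.linearIsometry.comp b.repr.toLinearIsometry, fun x => ?_⟩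
  have h := hc.orthogonalFamily.linearIsometry_apply_single (i := x) (1 : ℂ)
  simp only [LinearIsometry.toSpanSingleton_apply, one_smul] at h
  exact (congrArg hc.orthogonalFamily.linearIsometry (b.repr_self x)).trans h

theorem HilbertBasis.clm_ext {ι H H' : Type*} [NormedAddCommGroup H] [InnerProductSpace ℂ H]
    [NormedAddCommGroup H'] [InnerProductSpace ℂ H'] (b : HilbertBasis ι ℂ H) {S T : H →L[ℂ] H'}
    (h : ∀ x, S (b x) = T (b x)) : S = T := by
  refine ContinuousLinearMap.ext_on
    (Submodule.dense_iff_topologicalClosure_eq_top.2 b.dense_span) ?_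
  rintro _ ⟨x, rfl⟩
  exact h x

/-- An injective morphism of branching systems gives an isometric intertwiner. -/
theorem RealizesBranching.exists_intertwiner {ι ι' : Type*} {B : BranchingSystem ι}
    {B' : BranchingSystem ι'} {b : HilbertBasis ι ℂ H} {b' : ι' → H'}
    (h : RealizesBranching π B b) (h' : RealizesBranching π' B' b') (hb' : Orthonormal ℂ b')
    {φ : ι → ι'} (hφ : Function.Injective φ) (hmap : ∀ i x, φ (B.map i x) = B'.map i (φ x)) :
    ∃ V : H →ₗᵢ[ℂ] H', (∀ x, V (b x) = b' (φ x)) ∧ ∀ a v, V (π a v) = π' a (V v) := by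
  obtain ⟨V, hV⟩ := b.exists_linearIsometry (hb'.comp φ hφ)
  simp only [Function.comp_apply] at hV
  -- Compatibility with the maps forces compatibility with letters and shifts, which the adjoint
  -- relations need.
  have key : ∀ x, φ x = B'.map (B.letter x) (φ (B.shift x)) := fun x => by
    rw [← hmap, B.map_letter_shift]
  have hletter : ∀ x, B'.letter (φ x) = B.letter x := fun x => by rw [key, B'.letter_map]
  have hshift : ∀ x, B'.shift (φ x) = φ (B.shift x) := fun x => by rw [key, B'.shift_map]
  refine ⟨V, hV, intertwines_of_gen V.toContinuousLinearMap (fun i v => ?_) fun i v => ?_⟩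
  · refine DFunLike.congr_fun (b.clm_ext (S := V.toContinuousLinearMap ∘L π (cuntzGen i))
      (T := π' (cuntzGen i) ∘L V.toContinuousLinearMap) fun x => ?_) v
    change V (π _ (b x)) = π' _ (V (b x))
    rw [h, hV, hV, h', hmap]
  · refine DFunLike.congr_fun (b.clm_ext (S := V.toContinuousLinearMap ∘L π (star (cuntzGen i)))
      (T := π' (star (cuntzGen i)) ∘L V.toContinuousLinearMap) fun x => ?_) v
    change V (π _ (b x)) = π' _ (V (b x))
    rw [hV]
    by_cases hi : B.letter x = i
    · rw [h.star_apply_of_eq hi, hV, h'.star_apply_of_eq ((hletter x).trans hi), hshift]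
    · rw [h.star_apply_of_ne (Ne.symm hi), map_zero,
        h'.star_apply_of_ne (by rw [hletter]; exact Ne.symm hi)]

/-- A basis vector that is no image of a basis vector would be orthogonal to every range `π(s_i)H`,
against `hsum`. Letter and shift are unique because the generators are isometries with orthogonal
ranges. -/
theorem IsPermutativeRep.exists_realizesBranching (hsum : IsSumOfRanges π)
    (hperm : IsPermutativeRep π) : ∃ (E : Set H) (B : BranchingSystem E) (b : HilbertBasis E ℂ H),
      RealizesBranching π B b := by
  obtain ⟨E, hE, htop, hmap⟩ := hperm
  have hpre : ∀ e : E, ∃ (i : ℕ+) (f : E), π (cuntzGen i) f = e := by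
    intro e
    by_contra! hne
    have hrange : ∀ i, LinearMap.range (π (cuntzGen i)).toLinearMap ≤
        (Submodule.span ℂ {(e : H)})ᗮ := by
      rintro i _ ⟨v, rfl⟩
      have hle : (Submodule.span ℂ E).topologicalClosure ≤
          (Submodule.span ℂ {(e : H)})ᗮ.comap (π (cuntzGen i)).toLinearMap := by
        refine Submodule.topologicalClosure_minimal _ (Submodule.span_le.2 fun f hf => ?_)
          ((Submodule.isClosed_orthogonal _).preimage (π (cuntzGen i)).continuous)
        refine Submodule.mem_orthogonal_singleton_iff_inner_right.2 ?_
        exact hE.2 (i := e) (j := ⟨_, hmap i f hf⟩) fun h =>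
          hne i ⟨f, hf⟩ (congrArg Subtype.val h).symm
      rw [htop] at hle
      exact hle trivial
    have hle := Submodule.topologicalClosure_minimal _ (iSup_le hrange)
      (Submodule.isClosed_orthogonal _)
    rw [show _ = (⊤ : Submodule ℂ H) from hsum] at hle
    have h0 : inner ℂ (e : H) e = 0 :=
      Submodule.mem_orthogonal_singleton_iff_inner_right.1 (hle trivial)
    exact hE.ne_zero e (inner_self_eq_zero.1 h0)
  choose d σ hσ using hpre
  have hinj : ∀ (i j : ℕ+) (v w : H), w ≠ 0 → π (cuntzGen i) v = π (cuntzGen j) w →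
      i = j ∧ v = w := by
    intro i j v w hw h
    have h1 := congrArg (π (star (cuntzGen j))) h
    rw [star_cuntzGen_apply] at h1
    have hij : j = i := by
      by_contra hne
      rw [star_cuntzGen_apply_of_ne _ hne] at h1
      exact hw h1.symm
    subst hij
    rw [star_cuntzGen_apply] at h1
    exact ⟨rfl, h1⟩
  have hu : ∀ (i : ℕ+) (x : E), d ⟨_, hmap i x x.2⟩ = i ∧ (σ ⟨_, hmap i x x.2⟩ : H) = x :=
    fun i x => hinj _ _ _ _ (hE.ne_zero x) (hσ ⟨_, hmap i x x.2⟩)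
  refine ⟨E, ⟨fun i x => ⟨_, hmap i x x.2⟩, d, σ, fun x => Subtype.ext (hσ x),
    fun i x => (hu i x).1, fun i x => Subtype.ext (hu i x).2⟩,
    HilbertBasis.mk hE (by rw [Subtype.range_coe, htop]), fun i x => ?_⟩
  rw [HilbertBasis.coe_mk]

/-- The basis vectors whose orbits meet that of `y` span an invariant subspace; by irreducibility it
is everything, so no basis vector is left out. -/
theorem RealizesBranching.exists_iterate_eq {ι : Type*} {B : BranchingSystem ι}
    {b : HilbertBasis ι ℂ H} (h : RealizesBranching π B b) (hπ : IsIrreducibleRep π) (x y : ι) :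
    ∃ m n, B.shift^[m] x = B.shift^[n] y := by
  by_contra! hne
  set S := b '' {z | ∃ m n, B.shift^[m] z = B.shift^[n] y} with hS
  have hinv : IsInvariantSubspace π (Submodule.span ℂ S).topologicalClosure := by
    refine isInvariantSubspace_closure_span ?_ ?_
    · rintro i _ ⟨z, ⟨m, n, hz⟩, rfl⟩
      rw [h]
      exact ⟨_, ⟨m + 1, n, by rw [B.shift_iterate_succ_map, hz]⟩, rfl⟩
    · rintro i _ ⟨z, ⟨m, n, hz⟩, rfl⟩
      by_cases hi : B.letter z = i
      · rw [h.star_apply_of_eq hi]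
        refine Or.inl ⟨_, ⟨m, n + 1, ?_⟩, rfl⟩
        rw [← Function.iterate_succ_apply, Function.iterate_succ_apply', hz,
          Function.iterate_succ_apply']
      · exact Or.inr (h.star_apply_of_ne (Ne.symm hi))
  have htop := hπ.eq_top (Submodule.isClosed_topologicalClosure _) hinv
    (Submodule.le_topologicalClosure _ (Submodule.subset_span ⟨y, ⟨0, 0, rfl⟩, rfl⟩))
    (b.orthonormal.ne_zero y)
  have hle : (Submodule.span ℂ S).topologicalClosure ≤ (Submodule.span ℂ {b x})ᗮ := by
    refine Submodule.topologicalClosure_minimal _ (Submodule.span_le.2 ?_)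
      (Submodule.isClosed_orthogonal _)
    rintro _ ⟨z, ⟨m, n, hz⟩, rfl⟩
    refine Submodule.mem_orthogonal_singleton_iff_inner_right.2 (b.orthonormal.2 ?_)
    rintro rfl
    exact hne m n hz
  rw [htop] at hle
  have h0 : inner ℂ (b x) (b x) = 0 :=
    Submodule.mem_orthogonal_singleton_iff_inner_right.1 (hle trivial)
  exact b.orthonormal.ne_zero x (inner_self_eq_zero.1 h0)

/-- A self-adjoint operator in the commutant of an irreducible representation is definite. -/
theorem IsIrreducibleRep.nonneg_or_nonpos (hπ : IsIrreducibleRep π) {S : H →L[ℂ] H}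
    (hS : IsSelfAdjoint S) (hcomm : ∀ a, Commute S (π a)) : 0 ≤ S ∨ S ≤ 0 := by
  have hpos : ∀ a, Commute (S⁺) (π a) := fun a => by
    rw [CFC.posPart_def]
    exact (hcomm a).cfcₙ_real _
  -- The kernel of `S⁺` is `0` or everything. Since `S⁺ S⁻ = 0`, the first case kills `S⁻`; the
  -- second kills `S⁺`.
  have hinv : IsInvariantSubspace π (LinearMap.ker (S⁺).toLinearMap) := by
    intro a v hv
    change S⁺ (π a v) = 0
    have h1 := DFunLike.congr_fun (hpos a) v
    change S⁺ (π a v) = π a (S⁺ v) at h1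
    rw [h1, show S⁺ v = 0 from hv, map_zero]
  rcases hπ.2 _ (S⁺).isClosed_ker hinv with h | h
  · left
    rw [← CFC.negPart_eq_zero_iff S hS]
    ext v
    have h1 : S⁻ v ∈ LinearMap.ker (S⁺).toLinearMap :=
      DFunLike.congr_fun (CFC.posPart_mul_negPart S) v
    rw [h, Submodule.mem_bot] at h1
    rw [h1]
    rfl
  · right
    rw [← CFC.posPart_eq_zero_iff S hS]
    ext v
    have h1 : v ∈ LinearMap.ker (S⁺).toLinearMap := h ▸ trivial
    exact h1

/-- The commutant is closed under adjoints, so the definiteness result applies to `T + T*`, whose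
quadratic form is twice the real part of that of `T`. -/
theorem IsIrreducibleRep.re_inner_nonneg_or (hπ : IsIrreducibleRep π) {T : H →L[ℂ] H}
    (hT : ∀ a v, T (π a v) = π a (T v)) :
    (∀ v, 0 ≤ (inner ℂ v (T v)).re) ∨ ∀ v, (inner ℂ v (T v)).re ≤ 0 := by
  have hc : ∀ a, Commute T (π a) := fun a => ContinuousLinearMap.ext (hT a)
  have hc' : ∀ a, Commute (star T) (π a) := fun a => by
    have := (hc (star a)).star_star
    rwa [map_star, star_star] at this
  have hre : ∀ v, (inner ℂ v ((T + star T) v)).re = 2 * (inner ℂ v (T v)).re := by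
    intro v
    rw [_root_.add_apply, inner_add_right, ContinuousLinearMap.star_eq_adjoint,
      ContinuousLinearMap.adjoint_inner_right, Complex.add_re, ← inner_conj_symm (T v) v,
      Complex.conj_re]
    ring
  rcases hπ.nonneg_or_nonpos (IsSelfAdjoint.add_star_self T)
    fun a => (hc a).add_left (hc' a) with h | h
  · left
    intro v
    have h1 := ((ContinuousLinearMap.nonneg_iff_isPositive _).1 h).re_inner_nonneg_right v
    change 0 ≤ (inner ℂ v ((T + star T) v)).re at h1
    rw [hre] at h1
    linarith
  · right
    intro v
    have h1 := ((ContinuousLinearMap.nonneg_iff_isPositive _).1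
      (neg_nonneg.2 h)).re_inner_nonneg_right v
    change 0 ≤ (inner ℂ v (-((T + star T) v))).re at h1
    rw [inner_neg_right, Complex.neg_re, hre] at h1
    linarith

/-- Otherwise skipping one period gives an isometry `V` in the commutant with `V b_y = b_x` and `V
b_x` a basis vector other than `b_x`. Its form is negative at `b_y - b_x` and positive at `b_y +
b_x`, whether or not `V b_x = b_y`. -/
theorem RealizesBranching.not_shift_iterate_eq {ι : Type*} {B : BranchingSystem ι}
    {b : HilbertBasis ι ℂ H} (h : RealizesBranching π B b) (hπ : IsIrreducibleRep π) {x y : ι}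
    (hxy : x ≠ y) (hl : B.letters x = B.letters y) (m k : ℕ) :
    B.shift^[m] x ≠ B.shift^[m + k] y := by
  classical
  intro hm
  have hper := B.exists_eventual_period hl hm fun z => h.exists_iterate_eq hπ z x
  have hskip := B.skip_eq_of_letters_eq hper hl hm
  obtain ⟨V, hV, hint⟩ := h.exists_intertwiner h b.orthonormal (B.skip_injective hper)
    (B.skip_map hper)
  have hne : B.skip hper x ≠ x := fun h' => hxy (B.skip_injective hper (h'.trans hskip.symm))
  have hb := orthonormal_iff_ite.1 b.orthonormal
  have hVy : V (b y) = b x := by rw [hV, hskip]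
  rcases hπ.re_inner_nonneg_or (T := V.toContinuousLinearMap) hint with h1 | h1
  · have := h1 (b y - b x)
    simp only [LinearIsometry.coe_toContinuousLinearMap, map_sub, hVy, hV x, inner_sub_left,
      inner_sub_right, hb, hxy.symm, hne.symm, if_true, if_false] at this
    split_ifs at this <;> norm_num at this
  · have := h1 (b y + b x)
    simp only [LinearIsometry.coe_toContinuousLinearMap, map_add, hVy, hV x, inner_add_left,
      inner_add_right, hb, hxy.symm, hne.symm, if_true, if_false] at this
    split_ifs at this <;> norm_num at this

theorem RealizesBranching.code_injective {ι : Type*} {B : BranchingSystem ι}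
    {b : HilbertBasis ι ℂ H} (h : RealizesBranching π B b) (hπ : IsIrreducibleRep π) :
    Function.Injective B.code := by
  intro x y hxy
  by_contra hne
  have hl := B.letters_eq_of_code_eq hxy
  obtain ⟨m, n, hmn⟩ := h.exists_iterate_eq hπ x y
  rcases le_total m n with hle | hle
  · obtain ⟨k, rfl⟩ := Nat.exists_eq_add_of_le hle
    exact h.not_shift_iterate_eq hπ hne hl m k hmn
  · obtain ⟨k, rfl⟩ := Nat.exists_eq_add_of_le hle
    exact h.not_shift_iterate_eq hπ (Ne.symm hne) hl.symm n k hmn.symm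

/-- The preimage of the class subspace under `V` is invariant and contains `v ≠ 0`, so it is all of
`H`; the range of `V` is closed, invariant and contains `stdBasis x`, hence the whole class
subspace. -/
theorem IsIrreducibleRep.unitarilyEquivalent_eta (hπ : IsIrreducibleRep π)
    (hinv : ∀ q, IsInvariantSubspace piAlpha (classSubspace q)) (V : H →ₗᵢ[ℂ] L2Omega)
    (hV : ∀ a v, V (π a v) = piAlpha a (V v)) {v : H} {x : Omega} (hx : V v = stdBasis x) :
    UnitarilyEquivalent π (eta hinv (Quotient.mk omegaSetoid x)) := by
  have hv : v ≠ 0 := by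
    rintro rfl
    exact stdBasis_ne_zero x (by rw [← hx, map_zero])
  have hmem : ∀ w, V w ∈ classSubspace (Quotient.mk omegaSetoid x) := by
    have htop := hπ.eq_top
      (K := (classSubspace (Quotient.mk omegaSetoid x)).comap V.toLinearMap)
      ((Submodule.isClosed_topologicalClosure _).preimage V.continuous) (fun a w hw => by
        change V (π a w) ∈ classSubspace _
        rw [hV]
        exact hinv _ a _ hw)
      (v := v) (by
        change V v ∈ classSubspace _
        rw [hx]
        exact stdBasis_mem_classSubspace rfl) hv
    intro w
    have : w ∈ (⊤ : Submodule ℂ H) := trivial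
    rw [← htop] at this
    exact this
  have hrinv : IsInvariantSubspace piAlpha (LinearMap.range V.toLinearMap) := by
    rintro a _ ⟨w, rfl⟩
    exact ⟨π a w, hV a w⟩
  have hle : classSubspace (Quotient.mk omegaSetoid x) ≤ LinearMap.range V.toLinearMap := by
    refine classSubspace_le ?_ fun y hy => ?_
    · exact V.isometry.isClosedEmbedding.isClosed_range
    · exact stdBasis_mem_of_mk_eq hrinv hy.symm ⟨v, hx⟩
  let W : H →ₗᵢ[ℂ] classSubspace (Quotient.mk omegaSetoid x) :=
    ⟨V.toLinearMap.codRestrict _ hmem, fun w => V.norm_map w⟩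
  have hW : Function.Surjective W := by
    intro w
    obtain ⟨u, hu⟩ := hle w.2
    exact ⟨u, Subtype.ext hu⟩
  let U := LinearIsometryEquiv.ofSurjective W hW
  refine ⟨U, fun a w => ?_⟩
  obtain ⟨u, rfl⟩ := U.surjective w
  rw [U.symm_apply_apply]
  exact Subtype.ext (hV a u)

theorem IsPermutativeRep.exists_unitarilyEquivalent_eta
    (hinv : ∀ q, IsInvariantSubspace piAlpha (classSubspace q)) (hsum : IsSumOfRanges π)
    (hperm : IsPermutativeRep π) (hπ : IsIrreducibleRep π) :
    ∃ x : Omega, UnitarilyEquivalent π (eta hinv (Quotient.mk omegaSetoid x)) := by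
  obtain ⟨E, B, b, hB⟩ := hperm.exists_realizesBranching hsum
  obtain ⟨V, hVb, hV⟩ := hB.exists_intertwiner (π' := piAlpha) (B' := omegaBranching)
    (b' := stdBasis) piAlpha_cuntzGen_stdBasis orthonormal_stdBasis (hB.code_injective hπ)
    B.code_map
  have hne : Nonempty E := by
    by_contra hempty
    rw [not_nonempty_iff] at hempty
    have := hπ.1
    obtain ⟨v, hv⟩ := exists_ne (0 : H)
    have h0 : ContinuousLinearMap.id ℂ H = 0 := b.clm_ext fun x => isEmptyElim x
    exact hv (DFunLike.congr_fun h0 v)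
  obtain ⟨e⟩ := hne
  exact ⟨B.code e, hπ.unitarilyEquivalent_eta hinv V hV (hVb e)⟩

end Permutative

end

theorem theorem1p2 :
    ∃ hinv : ∀ q, IsInvariantSubspace piAlpha (classSubspace q),
      -- (i)
      (IsHilbertSum ℂ (fun q => classSubspace q) (fun q => (classSubspace q).subtypeₗᵢ) ∧
        ∀ q, IsIrreducibleRep (eta hinv q)) ∧
      -- (ii)
      ((∀ x y : Omega, UnitarilyEquivalent (eta hinv ⟦x⟧) (eta hinv ⟦y⟧) ↔
          ModularEquiv (x : ℝ) (y : ℝ)) ∧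
        IsMultiplicityFree piAlpha) ∧
      -- (iii)
      ((∀ x : Omega, ¬ IsQuadratic x → IsChainRep (cfe x) (eta hinv ⟦x⟧)) ∧
        (∀ x : Omega, IsQuadratic x →
          (∃ J, IsRepeatingBlock (cfe x) J) ∧
            ∀ J, IsRepeatingBlock (cfe x) J → IsCycleRep J (eta hinv ⟦x⟧))) ∧
      -- (iv)
      (∀ (H : Type*) [NormedAddCommGroup H] [InnerProductSpace ℂ H] [CompleteSpace H]
        (π : CuntzAlgebra →⋆ₐ[ℂ] (H →L[ℂ] H)),
        IsSumOfRanges π → IsPermutativeRep π → IsIrreducibleRep π →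
          ∃ x : Omega, UnitarilyEquivalent π (eta hinv ⟦x⟧)) := by
  exact ⟨isInvariantSubspace_classSubspace,
    ⟨isHilbertSum_classSubspace, isIrreducibleRep_eta _⟩,
    ⟨unitarilyEquivalent_eta_iff _, isMultiplicityFree_piAlpha⟩,
    ⟨fun _ hx => isChainRep_eta _ hx,
      fun _ hx => ⟨hx.exists_isRepeatingBlock, fun _ hJ => isCycleRep_eta _ hJ⟩⟩,
    fun _ _ _ _ _ hsum hperm hirr => hperm.exists_unitarilyEquivalent_eta _ hsum hirr⟩
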